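/- Let $(\Omega,\mathcal F,\mathsf P)$ be a probability space, $d\ge 2$, $n\ge 1$, and let $\mathcal F_0\subset\mathcal F_1\subset\dots\subset\mathcal F_n\subset\mathcal F$ be $\sigma$-fields. Let $X_1,\dots,X_n$ be random vectors in $\mathbb R^d$ such that $X_i$ is $\mathcal F_i$-measurable, $\mathsf E[X_i\mid\mathcal F_{i-1}]=0$ a.s., and $\mathsf E[\|X_i\|_\infty^3\mid\mathcal F_0]<\infty$ a.s. for all $1\le i\le n$. (The $X_i$ need not be integrable: $\mathsf E[\,\cdot\mid\mathcal G]$ of a real random variable $f$ with $\mathsf E[|f|\mid\mathcal G]<\infty$ a.s. means $\mathsf E[f^+\mid\mathcal G]-\mathsf E[f^-\mid\mathcal G]$.) Put $S=\sum_{i=1}^n X_i$ and $M(x)=\max_{1\le j\le d}x_j$ for $x\in\mathbb R^d$. Let $V$ be a version of $\mathsf E[SS^\top\mid\mathcal F_0]$, and let $T$ be a random vector in $\mathbb R^d$ on $\Omega$ whose conditional distribution given $\mathcal F_0$ is $N(0,V)$, i.e. $\mathsf E[e^{it^\top T}\mid\mathcal F_0]=\exp(-\tfrac12 t^\top Vt)$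 a.s. for every $t\in\mathbb R^d$. For each $i$ let $\Sigma_i$ be a version of $\mathsf E[X_iX_i^\top\mid\mathcal F_0]$ and $\overline\sigma_i^2=\max_{1\le j\le d}[\Sigma_i]_{jj}$, and define $$\Gamma=\sum_{i=1}^n\Big(\mathsf E[\|X_i\|_\infty^3\mid\mathcal F_0]+\big(\overline\sigma_i^2\,(1\vee\ln d)\big)^{3/2}\Big),\qquad \underline v^2=\min_{1\le j\le d}V_{jj},\qquad \overline v^2=\max_{1\le j\le d}V_{jj},$$ with $\underline v,\overline v\ge 0$, and, on $\{\underline v>0\}$, $\tau=\overline v/\underline v$ and $\Gamma'=\Gamma/\underline v^3$. There is a universal constant $C>0$ (depending on nothing, in particular not on $n$, $d$, the probability space, the $\sigma$-fields or the $X_i$) such that the following holds. If $\underline v>0$ a.s. and, for every $1<i\le n$, $\mathsf E[X_iX_i^\top\mid\mathcal F_{i-1}]$ is (has a version that is) $\mathcal F_0$-measurable, then $$\sup_{r\in\mathbb R}\big|F_{M(S)}(\cdot,r)-F_{M(T)}(\cdot,r)\big|\le C\,(\ln(dn))^{7/8}\,(\tau^3\Gamma')^{1/4}\quad\text{a.s.},$$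 where $F_{M(S)}$ and $F_{M(T)}$ are any regular conditional distribution functions of $M(S)$ and $M(T)$ given $\mathcal F_0$: for every $r$, $F_Z(\cdot,r)$ is a version of $\mathsf P(Z\le r\mid\mathcal F_0)$, and for every $\omega$, $F_Z(\omega,\cdot)$ is a distribution function. -/

import Mathlib

open MeasureTheory ProbabilityTheory Filter Topology

noncomputable section

namespace MDSBerryEsseen

/-- The conditional expectation `E[f ∣ m] = E[f⁺ ∣ m] - E[f⁻ ∣ m]` of a real random variable that
is conditionally integrable, `E[|f| ∣ m] < ∞` a.s., but not necessarily integrable.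
(For an integrable `f` it agrees almost surely with `μ[f | m]`.) -/
def condExpect {Ω : Type*} (m : MeasurableSpace Ω) {mΩ : MeasurableSpace Ω} (μ : Measure Ω)
    (f : Ω → ℝ) : Ω → ℝ :=
  fun ω => (condLExp m μ (fun x => ENNReal.ofReal (f x)) ω).toReal
    - (condLExp m μ (fun x => ENNReal.ofReal (-f x)) ω).toReal

/-- The conditional second moment matrix `E[Y Yᵀ ∣ m]`. -/
def condSecondMoment {Ω : Type*} (m : MeasurableSpace Ω) {mΩ : MeasurableSpace Ω} (μ : Measure Ω)
    {d : ℕ} (Y : Ω → Fin d → ℝ) : Ω → Matrix (Fin d) (Fin d) ℝ :=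
  fun ω => Matrix.of fun j k => condExpect m μ (fun x => Y x j * Y x k) ω

/-- `M(x) = max_j x_j`. -/
def maxCoord {d : ℕ} (x : Fin d → ℝ) : ℝ := ⨆ j, x j

/-- `1 ∨ ln x`. -/
def lnp (x : ℝ) : ℝ := max 1 (Real.log x)

/-- `X_1, …, X_n` (here `X 0, …, X (n-1)`) is a martingale difference sequence in `ℝ^d` with respect
to the σ-fields `F_0 ⊆ F_1 ⊆ … ⊆ F_n`, with finite conditional third moments given `F_0`.
`Fin d → ℝ` carries the maximum norm. -/
structure IsMDS {Ω : Type*} {mΩ : MeasurableSpace Ω} (μ : Measure Ω) {n d : ℕ}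
    (F : Filtration (Fin (n + 1)) mΩ) (X : Fin n → Ω → Fin d → ℝ) : Prop where
  adapted : ∀ i, Measurable[F i.succ] (X i)
  third_moment : ∀ i, ∀ᵐ ω ∂μ, condLExp (F 0) μ (fun x => ‖X i x‖ₑ ^ 3) ω < ⊤
  condExpect_eq_zero : ∀ i j, ∀ᵐ ω ∂μ, condExpect (F i.castSucc) μ (fun x => X i x j) ω = 0

/-- The sum `S = ∑_i X_i`. -/
def total {Ω : Type*} {n d : ℕ} (X : Fin n → Ω → Fin d → ℝ) : Ω → Fin d → ℝ :=
  fun ω => ∑ i, X i ω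

/-- The conditional distribution of the random vector `T` given `m` is the centred normal
distribution with covariance matrix `V`, through the conditional characteristic function. -/
def IsCondGaussian {Ω : Type*} (m : MeasurableSpace Ω) {mΩ : MeasurableSpace Ω} (μ : Measure Ω)
    {d : ℕ} (T : Ω → Fin d → ℝ) (V : Ω → Matrix (Fin d) (Fin d) ℝ) : Prop :=
  Measurable[mΩ] T ∧ ∀ t : Fin d → ℝ,
    μ[fun x => Complex.exp (Complex.I * ((t ⬝ᵥ T x : ℝ) : ℂ)) | m]
      =ᵐ[μ] fun ω => ((Real.exp (-(1 / 2) * (t ⬝ᵥ (V ω).mulVec t)) : ℝ) : ℂ)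

/-- `G` is a regular conditional cumulative distribution function of `Z` given `m`: each `G(·, r)`
is a version of `P(Z ≤ r ∣ m)`, and each `G(ω, ·)` is a distribution function. -/
structure IsCondCDF {Ω : Type*} (m : MeasurableSpace Ω) {mΩ : MeasurableSpace Ω} (μ : Measure Ω)
    (Z : Ω → ℝ) (G : Ω → ℝ → ℝ) : Prop where
  measurable : ∀ r, Measurable[m] fun ω => G ω r
  ae_eq : ∀ r, (fun ω => G ω r) =ᵐ[μ] μ[Set.indicator {x | Z x ≤ r} (fun _ => (1 : ℝ)) | m]
  mono : ∀ ω, Monotone (G ω)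
  right_continuous : ∀ ω r, ContinuousWithinAt (G ω) (Set.Ici r) r
  tendsto_atBot : ∀ ω, Tendsto (G ω) atBot (𝓝 0)
  tendsto_atTop : ∀ ω, Tendsto (G ω) atTop (𝓝 1)

/-- The conditional Kolmogorov distance of two random variables with regular conditional
distribution functions `G` and `H`. -/
def kolmogorovDist {Ω : Type*} (G H : Ω → ℝ → ℝ) (ω : Ω) : ℝ := ⨆ r : ℝ, |G ω r - H ω r|

/-- `v̲ = (min_j V_jj)^{1/2}`. -/
def vLow {d : ℕ} (V : Matrix (Fin d) (Fin d) ℝ) : ℝ := Real.sqrt (⨅ j, V j j)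

/-- `v̄ = (max_j V_jj)^{1/2}`. -/
def vHigh {d : ℕ} (V : Matrix (Fin d) (Fin d) ℝ) : ℝ := Real.sqrt (⨆ j, V j j)

/-- `Γ = ∑_i (E[‖X_i‖_∞³ ∣ F_0] + (σ̄_i² (1 ∨ ln d))^{3/2})`, where `σ̄_i²` is the largest diagonal
entry of `E[X_i X_iᵀ ∣ F_0]`. -/
def bigGamma {Ω : Type*} (m : MeasurableSpace Ω) {mΩ : MeasurableSpace Ω} (μ : Measure Ω)
    {n d : ℕ} (X : Fin n → Ω → Fin d → ℝ) (ω : Ω) : ℝ :=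
  ∑ i, (condExpect m μ (fun x => ‖X i x‖ ^ 3) ω
    + ((⨆ j, condSecondMoment m μ (X i) ω j j) * lnp d) ^ (3 / 2 : ℝ))

/-- `τ = v̄ / v̲`. -/
def tau {d : ℕ} (V : Matrix (Fin d) (Fin d) ℝ) : ℝ := vHigh V / vLow V

end MDSBerryEsseen

end

/-! ### Centred Gaussian laws identified by their characteristic functions. -/

namespace MDSBerryEsseen

/-! Disintegrate over `F 0`. Let `κ_ω` be the regular conditional law of `(X_1, …, X_n)` given `F
0`. For almost every `ω`, all quantities in the bound belong to `κ_ω`: `V` and `Γ` are moments of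
it, the conditional distribution function of `M(S)` is that of the maximum of the sum under `κ_ω`,
and the conditional law of `T` is `N(0, V ω)`. A conditional covariance given `F_{i-1}` that is
`F_0`-measurable becomes a constant matrix `W_i ω` under `κ_ω` (`condExp_condLaw_ae_eq_const`).
Hence under `κ_ω` the increments are integrable to the third power, are centred given the preceding
partial sum, and have deterministic covariances with sum `V ω`. What remains is an unconditional
statement, `exists_kolmogorov_bound`.

That statement is Lindeberg's method. The increments are exchanged for independent `N(0, W_i)`
vectors, beginning with the last. Since `W_i` is deterministic, the Taylor terms of order one and
two agree, and an exchange costs a third order constant times the sum of third moments; the Gaussian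
one is of order `(σ̄_i² (1 ∨ ln d))^{3/2}` (`HasGaussianCharFun.third_moment`). The test function is
a smooth step of width `δ` applied to a log-sum-exp maximum, with third order constant of order
`(log d)² / δ³` (`exists_smooth_indicator`). Returning to indicators costs the Gaussian probability
that the maximum lies in an interval of length `2δ`, which is of order `δ √(log d) / v` by Nazarov's
inequality (`HasGaussianCharFun.anticoncentration`).

With `δ = v (log d)^{3/8} Γ'^{1/4}` both errors are of order `(log d)^{7/8} Γ'^{1/4}`. The stated
bound is weaker, because `log d ≤ log (d n)` and `τ ≥ 1`. -/

/-- The measure `ρ` on `ℝ^d` has the characteristic function of `N(0, V)`. -/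
def HasGaussianCharFun {d : ℕ} (ρ : Measure (Fin d → ℝ)) (V : Matrix (Fin d) (Fin d) ℝ) : Prop :=
  ∀ t : Fin d → ℝ, ∫ x, Complex.exp (Complex.I * ((t ⬝ᵥ x : ℝ) : ℂ)) ∂ρ
    = ((Real.exp (-(1 / 2) * (t ⬝ᵥ V.mulVec t)) : ℝ) : ℂ)

/-- The linear functional `x ↦ t ⬝ᵥ x`. -/
noncomputable def dotCLM {d : ℕ} (t : Fin d → ℝ) : StrongDual ℝ (Fin d → ℝ) :=
  ∑ j, t j • ContinuousLinearMap.proj (R := ℝ) (φ := fun _ : Fin d => ℝ) j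

lemma dotCLM_apply {d : ℕ} (t x : Fin d → ℝ) : dotCLM t x = t ⬝ᵥ x := by
  simp [dotCLM, dotProduct]

lemma eq_dotCLM {d : ℕ} (L : StrongDual ℝ (Fin d → ℝ)) :
    L = dotCLM (fun j => L (Pi.single j 1)) := by
  ext x
  rw [dotCLM_apply, dotProduct]
  conv_lhs => rw [pi_eq_sum_univ' x]
  simp [map_sum, mul_comm]

lemma measurable_dotProduct {d : ℕ} (t : Fin d → ℝ) :
    Measurable fun x : Fin d → ℝ => t ⬝ᵥ x := by
  simp only [← dotCLM_apply]
  exact (dotCLM t).measurable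

lemma charFunDual_dotCLM {d : ℕ} (ρ : Measure (Fin d → ℝ)) (t : Fin d → ℝ) :
    charFunDual ρ (dotCLM t) = ∫ x, Complex.exp (Complex.I * ((t ⬝ᵥ x : ℝ) : ℂ)) ∂ρ := by
  simp only [charFunDual_apply, dotCLM_apply, mul_comm]

/-- Uniqueness turns every later Gaussian decomposition into an identity between covariance
matrices, so independence never has to be verified. -/
lemma HasGaussianCharFun.ext {d : ℕ} {ρ ρ' : Measure (Fin d → ℝ)} [IsProbabilityMeasure ρ]
    [IsProbabilityMeasure ρ'] {V : Matrix (Fin d) (Fin d) ℝ} (h : HasGaussianCharFun ρ V)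
    (h' : HasGaussianCharFun ρ' V) : ρ = ρ' := by
  apply Measure.ext_of_charFunDual
  ext L
  rw [eq_dotCLM L, charFunDual_dotCLM, charFunDual_dotCLM, h, h']

lemma exists_hasGaussianCharFun {d : ℕ} {V : Matrix (Fin d) (Fin d) ℝ} (hV : V.PosSemidef) :
    ∃ ρ : Measure (Fin d → ℝ), IsProbabilityMeasure ρ ∧ HasGaussianCharFun ρ V := by
  have hm : Measurable (WithLp.ofLp : EuclideanSpace ℝ (Fin d) → Fin d → ℝ) :=
    WithLp.measurable_ofLp 2 _
  refine ⟨(multivariateGaussian 0 V).map WithLp.ofLp,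
    Measure.isProbabilityMeasure_map hm.aemeasurable, fun t => ?_⟩
  rw [integral_map hm.aemeasurable]
  · have := charFun_multivariateGaussian (μ := 0) hV (WithLp.toLp 2 t)
    rw [charFun_apply] at this
    have e : ∀ x : EuclideanSpace ℝ (Fin d), inner ℝ x (WithLp.toLp 2 t) = t ⬝ᵥ x.ofLp := by
      intro x
      simp [PiLp.inner_apply, dotProduct]
    simp only [e] at this
    simp only [mul_comm Complex.I]
    rw [this]
    push_cast
    congr 1
    simp
    ring
  · apply Measurable.aestronglyMeasurable
    have := measurable_dotProduct t
    fun_prop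

lemma HasGaussianCharFun.conv {d : ℕ} {ρ ρ' : Measure (Fin d → ℝ)} [IsProbabilityMeasure ρ]
    [IsProbabilityMeasure ρ'] {V V' : Matrix (Fin d) (Fin d) ℝ} (h : HasGaussianCharFun ρ V)
    (h' : HasGaussianCharFun ρ' V') : HasGaussianCharFun (ρ.conv ρ') (V + V') := by
  intro t
  rw [← charFunDual_dotCLM, charFunDual_conv, charFunDual_dotCLM, charFunDual_dotCLM, h, h',
    ← Complex.ofReal_mul, ← Real.exp_add, Matrix.add_mulVec, dotProduct_add]
  ring_nf

lemma HasGaussianCharFun.map_dotProduct {d : ℕ} {ρ : Measure (Fin d → ℝ)} [IsProbabilityMeasure ρ]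
    {V : Matrix (Fin d) (Fin d) ℝ} (h : HasGaussianCharFun ρ V) (t : Fin d → ℝ)
    (ht : 0 ≤ t ⬝ᵥ V.mulVec t) :
    ρ.map (fun x => t ⬝ᵥ x) = gaussianReal 0 (t ⬝ᵥ V.mulVec t).toNNReal := by
  have hm := measurable_dotProduct t
  have : IsProbabilityMeasure (ρ.map (fun x => t ⬝ᵥ x)) :=
    Measure.isProbabilityMeasure_map hm.aemeasurable
  apply Measure.ext_of_charFun
  ext s
  rw [charFun_gaussianReal, charFun_apply_real, integral_map hm.aemeasurable (by fun_prop)]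
  have := h (s • t)
  simp only [smul_dotProduct, Matrix.mulVec_smul, dotProduct_smul, smul_eq_mul] at this
  rw [Real.coe_toNNReal _ ht]
  convert this using 1
  · congr 1
    ext x
    congr 1
    push_cast
    ring
  · push_cast
    congr 1
    ring

lemma HasGaussianCharFun.map_mulVec {d : ℕ} {ρ : Measure (Fin d → ℝ)}
    {V : Matrix (Fin d) (Fin d) ℝ} (h : HasGaussianCharFun ρ V) (A : Matrix (Fin d) (Fin d) ℝ) :
    HasGaussianCharFun (ρ.map A.mulVec) (A * V * A.transpose) := by
  intro t
  have hm : Measurable A.mulVec := (Matrix.mulVecLin A).continuous_of_finiteDimensional.measurable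
  rw [integral_map hm.aemeasurable]
  · simp only [Matrix.dotProduct_mulVec]
    rw [h (Matrix.vecMul t A)]
    congr 3
    rw [← Matrix.vecMul_vecMul, ← Matrix.vecMul_vecMul, ← Matrix.dotProduct_mulVec,
      ← Matrix.dotProduct_mulVec, ← Matrix.dotProduct_mulVec]
    rw [Matrix.mulVec_transpose, Matrix.dotProduct_mulVec]
  · apply Measurable.aestronglyMeasurable
    have := measurable_dotProduct t
    fun_prop

lemma hasGaussianCharFun_map_smul {d : ℕ} (v : NNReal) (c : Fin d → ℝ) :
    HasGaussianCharFun ((gaussianReal 0 v).map (fun ξ => ξ • c))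
      ((v : ℝ) • Matrix.vecMulVec c c) := by
  intro t
  have hm : Measurable fun ξ : ℝ => ξ • c := by fun_prop
  rw [integral_map hm.aemeasurable]
  · have := charFun_gaussianReal (μ := 0) (v := v) (t ⬝ᵥ c)
    rw [charFun_apply_real] at this
    convert this using 1
    · congr 1
      ext x
      congr 1
      simp only [dotProduct_smul, smul_eq_mul]
      push_cast
      ring
    · rw [Matrix.smul_mulVec, Matrix.vecMulVec_mulVec]
      simp [dotProduct_smul, dotProduct_comm c t]
      ring_nf
  · apply Measurable.aestronglyMeasurable
    have := measurable_dotProduct t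
    fun_prop

end MDSBerryEsseen

/-! ### Moments of Gaussian vectors, in particular the third moment of the maximum norm. -/

namespace MDSBerryEsseen

/-- The divisor leaves room for a union bound over `d` coordinates, each with exponential moment at
most `e^{a/2}`. Below `3/2` the cube is at most `27/8`; above it `u³ ≤ 6 e^u`, and `a u - 3a/2 ≥ u -
3/2` because `a ≥ 1`. -/
lemma cube_le_add_exp {d a u : ℝ} (hd : 0 < d) (ha : 1 ≤ a) (hda : d ≤ Real.exp a) (hu : 0 ≤ u) :
    u ^ 3 ≤ 4 + 6 * Real.exp (3 / 2) * (Real.exp (a * u) / (d * Real.exp (a / 2))) := by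
  have hexp := Real.exp_pos (3 / 2 : ℝ)
  rcases le_total u (3 / 2) with h | h
  · have : u ^ 3 ≤ (3 / 2) ^ 3 := by gcongr
    have h2 : 0 ≤ 6 * Real.exp (3 / 2) * (Real.exp (a * u) / (d * Real.exp (a / 2))) := by
      positivity
    linarith
  · have h1 : u ^ 3 / 6 ≤ Real.exp u := by
      have := Real.pow_div_factorial_le_exp u hu 3
      norm_num [Nat.factorial] at this
      exact this
    have h2 : Real.exp (u - 3 / 2) ≤ Real.exp (a * u) / (d * Real.exp (a / 2)) := by
      rw [le_div_iff₀ (by positivity)]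
      calc Real.exp (u - 3 / 2) * (d * Real.exp (a / 2))
          ≤ Real.exp (u - 3 / 2) * (Real.exp a * Real.exp (a / 2)) := by gcongr
        _ = Real.exp (u - 3 / 2 + (a + a / 2)) := by rw [Real.exp_add, Real.exp_add]
        _ ≤ Real.exp (a * u) := by
          apply Real.exp_le_exp.2
          nlinarith
    have h3 : Real.exp (3 / 2) * Real.exp (u - 3 / 2) = Real.exp u := by
      rw [← Real.exp_add]
      ring_nf
    nlinarith [mul_le_mul_of_nonneg_left h2 hexp.le]

variable {d : ℕ} {ρ : Measure (Fin d → ℝ)} {V : Matrix (Fin d) (Fin d) ℝ}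

lemma single_dotProduct_mulVec_single (V : Matrix (Fin d) (Fin d) ℝ) (j k : Fin d) :
    (Pi.single j 1 : Fin d → ℝ) ⬝ᵥ V.mulVec (Pi.single k 1) = V j k := by
  simp

lemma PosSemidef.dotProduct_nonneg (hV : V.PosSemidef) (t : Fin d → ℝ) :
    0 ≤ t ⬝ᵥ V.mulVec t := by
  simpa using hV.dotProduct_mulVec_nonneg t

lemma PosSemidef.diag_nonneg' (hV : V.PosSemidef) (j : Fin d) : 0 ≤ V j j := by
  simpa using PosSemidef.dotProduct_nonneg hV (Pi.single j 1)

lemma HasGaussianCharFun.map_eval [IsProbabilityMeasure ρ] (h : HasGaussianCharFun ρ V)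
    (hV : V.PosSemidef) (j : Fin d) :
    ρ.map (fun x => x j) = gaussianReal 0 (V j j).toNNReal := by
  have := h.map_dotProduct (Pi.single j 1) (PosSemidef.dotProduct_nonneg hV _)
  simpa using this

lemma HasGaussianCharFun.integrable_comp_dotProduct [IsProbabilityMeasure ρ]
    (h : HasGaussianCharFun ρ V) (hV : V.PosSemidef) (t : Fin d → ℝ) {f : ℝ → ℝ}
    (hf : Integrable f (gaussianReal 0 (t ⬝ᵥ V.mulVec t).toNNReal)) :
    Integrable (fun x => f (t ⬝ᵥ x)) ρ := by
  rw [← h.map_dotProduct t (PosSemidef.dotProduct_nonneg hV _)] at hf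
  exact hf.comp_measurable (measurable_dotProduct t)

lemma HasGaussianCharFun.integral_comp_dotProduct [IsProbabilityMeasure ρ]
    (h : HasGaussianCharFun ρ V) (hV : V.PosSemidef) (t : Fin d → ℝ) {f : ℝ → ℝ}
    (hf : Measurable f) :
    ∫ x, f (t ⬝ᵥ x) ∂ρ = ∫ s, f s ∂(gaussianReal 0 (t ⬝ᵥ V.mulVec t).toNNReal) := by
  rw [← h.map_dotProduct t (PosSemidef.dotProduct_nonneg hV _),
    integral_map (measurable_dotProduct t).aemeasurable hf.aestronglyMeasurable]

lemma integral_sq_gaussianReal (v : NNReal) : ∫ s, s ^ 2 ∂(gaussianReal 0 v) = v := by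
  have h := variance_id_gaussianReal (μ := 0) (v := v)
  rw [variance_eq_integral (by fun_prop)] at h
  simpa using h

lemma HasGaussianCharFun.integral_eval [IsProbabilityMeasure ρ] (h : HasGaussianCharFun ρ V)
    (hV : V.PosSemidef) (j : Fin d) : ∫ x, x j ∂ρ = 0 := by
  have := h.integral_comp_dotProduct hV (Pi.single j 1) measurable_id
  simpa using this

lemma HasGaussianCharFun.memLp_eval [IsProbabilityMeasure ρ] (h : HasGaussianCharFun ρ V)
    (hV : V.PosSemidef) (j : Fin d) : MemLp (fun x => x j) 2 ρ := by
  have hm : Measurable fun x : Fin d → ℝ => x j := by fun_prop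
  have := memLp_id_gaussianReal (μ := 0) (v := (V j j).toNNReal) 2
  rw [← h.map_eval hV j] at this
  exact (memLp_map_measure_iff (by fun_prop) hm.aemeasurable).1 this

lemma HasGaussianCharFun.integral_dotProduct_sq [IsProbabilityMeasure ρ]
    (h : HasGaussianCharFun ρ V) (hV : V.PosSemidef) (t : Fin d → ℝ) :
    ∫ x, (t ⬝ᵥ x) ^ 2 ∂ρ = t ⬝ᵥ V.mulVec t := by
  rw [h.integral_comp_dotProduct hV t (f := fun s => s ^ 2) (by fun_prop),
    integral_sq_gaussianReal, Real.coe_toNNReal _ (PosSemidef.dotProduct_nonneg hV _)]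

lemma HasGaussianCharFun.integral_eval_mul_eval [IsProbabilityMeasure ρ]
    (h : HasGaussianCharFun ρ V) (hV : V.PosSemidef) (j k : Fin d) :
    ∫ x, x j * x k ∂ρ = V j k := by
  have h1 := h.integral_dotProduct_sq hV (Pi.single j 1)
  have h2 := h.integral_dotProduct_sq hV (Pi.single k 1)
  -- Polarization recovers the mixed moment from the quadratic form.
  have h3 := h.integral_dotProduct_sq hV (Pi.single j 1 + Pi.single k 1)
  have hs : V k j = V j k := by
    have := hV.isHermitian.apply j k
    simpa using this
  simp only [add_dotProduct, Matrix.mulVec_add, dotProduct_add, single_dotProduct_mulVec_single,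
    hs] at h1 h2 h3
  simp only [single_one_dotProduct] at h1 h2 h3
  have i1 := (h.memLp_eval hV j).integrable_sq
  have i2 := (h.memLp_eval hV k).integrable_sq
  have i3 : Integrable (fun x => x j * x k) ρ :=
    (h.memLp_eval hV j).integrable_mul (h.memLp_eval hV k)
  have e : ∀ x : Fin d → ℝ, (x j + x k) ^ 2 = x j ^ 2 + x k ^ 2 + 2 * (x j * x k) := by
    intro x; ring
  simp only [e] at h3
  have i12 : Integrable (fun x : Fin d → ℝ => x j ^ 2 + x k ^ 2) ρ := i1.add i2
  rw [integral_add i12 (i3.const_mul 2), integral_add i1 i2, integral_const_mul, h1, h2] at h3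
  linarith

lemma integral_exp_mul_gaussianReal (v : NNReal) (t : ℝ) :
    ∫ s, Real.exp (t * s) ∂(gaussianReal 0 v) = Real.exp (v * t ^ 2 / 2) := by
  have := mgf_gaussianReal (p := gaussianReal 0 v) (X := id) (μ := 0) (v := v) (by simp) t
  simpa [mgf] using this

/-- The cube of `‖x‖ / L` is dominated by a sum of exponentials `e^{±(a/L) x_j}` over all
coordinates. Each has mean `e^{V_jj a² / (2L²)} ≤ e^{a/2}`, and the normalisation `c` makes the sum
over `d` coordinates a universal constant. -/
lemma HasGaussianCharFun.third_moment_aux [IsProbabilityMeasure ρ] (h : HasGaussianCharFun ρ V)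
    (hV : V.PosSemidef) (hd : 1 < d) {L : ℝ} (hL : 0 < L)
    (hVL : ∀ j, V j j * lnp d ≤ L ^ 2) :
    Integrable (fun x => ‖x‖ ^ 3) ρ ∧
      ∫ x, ‖x‖ ^ 3 ∂ρ ≤ (4 + 12 * Real.exp (3 / 2)) * L ^ 3 := by
  set a := lnp d with ha_def
  have ha : 1 ≤ a := le_max_left _ _
  have hd0 : (0 : ℝ) < d := by positivity
  have hda : (d : ℝ) ≤ Real.exp a := by
    calc (d : ℝ) = Real.exp (Real.log d) := (Real.exp_log hd0).symm
      _ ≤ _ := Real.exp_le_exp.2 (le_max_right _ _)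
  set c : ℝ := 6 * Real.exp (3 / 2) / (d * Real.exp (a / 2)) with hc
  have hc0 : 0 < c := by positivity
  set B : (Fin d → ℝ) → ℝ := fun x =>
    L ^ 3 * (4 + ∑ j, c * (Real.exp ((a / L) * x j) + Real.exp ((-(a / L)) * x j))) with hB
  have hle : ∀ x, ‖x‖ ^ 3 ≤ B x := by
    intro x
    have hne : (Finset.univ : Finset (Fin d)).Nonempty := ⟨⟨0, by omega⟩, Finset.mem_univ _⟩
    obtain ⟨j, -, hj⟩ := Finset.exists_max_image Finset.univ (fun j => ‖x j‖) hne
    have hn : ‖x‖ = |x j| := by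
      apply le_antisymm
      · exact (pi_norm_le_iff_of_nonneg (norm_nonneg _)).2 fun k => hj k (Finset.mem_univ _)
      · exact norm_le_pi_norm x j
    have h1 := cube_le_add_exp hd0 ha hda (u := |x j| / L) (by positivity)
    have h2 : Real.exp (a * (|x j| / L)) ≤
        Real.exp ((a / L) * x j) + Real.exp ((-(a / L)) * x j) := by
      rcases abs_cases (x j) with ⟨h', -⟩ | ⟨h', -⟩ <;> rw [h']
      · have : a * (x j / L) = (a / L) * x j := by ring
        rw [this]
        linarith [Real.exp_pos ((-(a / L)) * x j)]
      · have : a * (-x j / L) = (-(a / L)) * x j := by ring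
        rw [this]
        linarith [Real.exp_pos ((a / L) * x j)]
    have h3 : c * (Real.exp ((a / L) * x j) + Real.exp ((-(a / L)) * x j)) ≤
        ∑ j, c * (Real.exp ((a / L) * x j) + Real.exp ((-(a / L)) * x j)) :=
      Finset.single_le_sum (f := fun j => c * (Real.exp ((a / L) * x j) +
        Real.exp ((-(a / L)) * x j))) (fun k _ => by positivity) (Finset.mem_univ j)
    have h4 : ‖x‖ ^ 3 = L ^ 3 * (|x j| / L) ^ 3 := by
      rw [hn]; field_simp
    rw [h4]
    refine mul_le_mul_of_nonneg_left ?_ (by positivity)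
    calc (|x j| / L) ^ 3 ≤ _ := h1
      _ = 4 + c * Real.exp (a * (|x j| / L)) := by rw [hc]; ring
      _ ≤ 4 + c * (Real.exp ((a / L) * x j) + Real.exp ((-(a / L)) * x j)) := by gcongr
      _ ≤ _ := by gcongr
  have hint : ∀ (s : ℝ) (j : Fin d), Integrable (fun x : Fin d → ℝ => Real.exp (s * x j)) ρ := by
    intro s j
    have := h.integrable_comp_dotProduct hV (Pi.single j 1) (f := fun y => Real.exp (s * y))
      (integrable_exp_mul_gaussianReal s)
    simpa using this
  have hval : ∀ (s : ℝ) (j : Fin d), s ^ 2 = (a / L) ^ 2 →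
      ∫ x : Fin d → ℝ, Real.exp (s * x j) ∂ρ ≤ Real.exp (a / 2) := by
    intro s j hs
    have := h.integral_comp_dotProduct hV (Pi.single j 1) (f := fun y => Real.exp (s * y))
      (by fun_prop)
    rw [single_dotProduct_mulVec_single, integral_exp_mul_gaussianReal,
      Real.coe_toNNReal _ (PosSemidef.diag_nonneg' hV j)] at this
    simp only [single_one_dotProduct] at this
    rw [this, hs]
    apply Real.exp_le_exp.2
    have h5 : V j j * (a / L) ^ 2 = (V j j * a) * a / L ^ 2 := by field_simp
    have h6 : V j j * (a / L) ^ 2 ≤ a := by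
      rw [h5, div_le_iff₀ (by positivity)]
      nlinarith [hVL j]
    linarith
  have hterm : ∀ j, Integrable (fun x : Fin d → ℝ =>
      c * (Real.exp ((a / L) * x j) + Real.exp ((-(a / L)) * x j))) ρ :=
    fun j => ((hint _ j).add (hint _ j)).const_mul _
  have hsum := integrable_finsetSum Finset.univ fun j _ => hterm j
  have hBint : Integrable B ρ := ((integrable_const _).add hsum).const_mul _
  refine ⟨hBint.mono' (by fun_prop) (ae_of_all _ fun x => ?_), ?_⟩
  · rw [Real.norm_of_nonneg (by positivity)]
    exact hle x
  · refine (integral_mono_of_nonneg (ae_of_all _ fun x => by positivity) hBint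
      (ae_of_all _ hle)).trans ?_
    rw [hB, integral_const_mul, integral_add (integrable_const _) hsum,
      integral_finsetSum _ fun j _ => hterm j]
    have h7 : ∀ j, ∫ x : Fin d → ℝ, c * (Real.exp ((a / L) * x j) + Real.exp ((-(a / L)) * x j)) ∂ρ
        ≤ c * (2 * Real.exp (a / 2)) := by
      intro j
      rw [integral_const_mul, integral_add (hint _ j) (hint _ j)]
      have := hval (a / L) j rfl
      have := hval (-(a / L)) j (by ring)
      gcongr
      linarith
    have h8 : ∑ j : Fin d, c * (2 * Real.exp (a / 2)) = 12 * Real.exp (3 / 2) := by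
      rw [Finset.sum_const, Finset.card_univ, Fintype.card_fin, nsmul_eq_mul, hc]
      field_simp
      norm_num
    have h9 := Finset.sum_le_sum (s := Finset.univ) fun (j : Fin d) _ => h7 j
    rw [h8] at h9
    simp only [integral_const, probReal_univ, smul_eq_mul, one_mul]
    rw [mul_comm]
    gcongr

/-- Third absolute moment of the maximum of a centred Gaussian vector. -/
lemma HasGaussianCharFun.third_moment [IsProbabilityMeasure ρ] (h : HasGaussianCharFun ρ V)
    (hV : V.PosSemidef) (hd : 1 < d) :
    Integrable (fun x => ‖x‖ ^ 3) ρ ∧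
      ∫ x, ‖x‖ ^ 3 ∂ρ ≤ (4 + 12 * Real.exp (3 / 2)) * ((⨆ j, V j j) * lnp d) ^ (3 / 2 : ℝ) := by
  have : Nonempty (Fin d) := ⟨⟨0, by omega⟩⟩
  have hl : 1 ≤ lnp d := le_max_left _ _
  have hb : ∀ j, V j j ≤ ⨆ j, V j j := fun j => le_ciSup (f := fun j => V j j) (Set.finite_range _).bddAbove j
  have hs : 0 ≤ ⨆ j, V j j := (PosSemidef.diag_nonneg' hV (Classical.arbitrary _)).trans (hb _)
  set q := (⨆ j, V j j) * lnp d with hq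
  have hq0 : 0 ≤ q := by positivity
  -- The scale `L` must be positive while `q` may vanish, so `q + ε` is used and `ε` tends to `0`.
  have key : ∀ ε > 0, Integrable (fun x => ‖x‖ ^ 3) ρ ∧
      ∫ x, ‖x‖ ^ 3 ∂ρ ≤ (4 + 12 * Real.exp (3 / 2)) * (√(q + ε)) ^ 3 := by
    intro ε hε
    refine h.third_moment_aux hV hd (by positivity) fun j => ?_
    rw [Real.sq_sqrt (by positivity)]
    have : V j j * lnp d ≤ q := by rw [hq]; gcongr; exact hb j
    linarith
  refine ⟨(key 1 one_pos).1, ?_⟩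
  have e : q ^ (3 / 2 : ℝ) = √q ^ 3 := by
    rw [Real.sqrt_eq_rpow, ← Real.rpow_natCast, ← Real.rpow_mul hq0]
    norm_num
  rw [e]
  have ht : Tendsto (fun ε : ℝ => (4 + 12 * Real.exp (3 / 2)) * (√(q + ε)) ^ 3) (𝓝[>] 0)
      (𝓝 ((4 + 12 * Real.exp (3 / 2)) * √q ^ 3)) := by
    have : Continuous fun ε : ℝ => (4 + 12 * Real.exp (3 / 2)) * (√(q + ε)) ^ 3 := by fun_prop
    have := (this.tendsto 0).mono_left (nhdsWithin_le_nhds (s := Set.Ioi 0))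
    simpa using this
  exact ge_of_tendsto ht (by filter_upwards [self_mem_nhdsWithin] with ε hε using (key ε hε).2)

end MDSBerryEsseen

/-! ### Nazarov's anti-concentration inequality. -/

namespace MDSBerryEsseen

lemma gaussianPDFReal_zero_one (x : ℝ) :
    gaussianPDFReal 0 1 x = (√(2 * Real.pi))⁻¹ * Real.exp (-(x ^ 2) / 2) := by
  simp [gaussianPDFReal]

lemma measureReal_gaussianReal (s : Set ℝ) :
    (gaussianReal 0 1).real s = ∫ x in s, gaussianPDFReal 0 1 x := by
  rw [measureReal_def, gaussianReal_apply_eq_integral _ one_ne_zero,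
    ENNReal.toReal_ofReal (integral_nonneg fun x => gaussianPDFReal_nonneg _ _ _)]

lemma gaussianPDFReal_le_of_sq_le {x y : ℝ} (h : y ^ 2 ≤ x ^ 2) :
    gaussianPDFReal 0 1 x ≤ gaussianPDFReal 0 1 y := by
  rw [gaussianPDFReal_zero_one, gaussianPDFReal_zero_one]
  gcongr

lemma gaussianPDFReal_le_exp (x : ℝ) : gaussianPDFReal 0 1 x ≤ Real.exp (-(x ^ 2) / 2) := by
  rw [gaussianPDFReal_zero_one]
  refine mul_le_of_le_one_left (Real.exp_pos _).le (inv_le_one_of_one_le₀ ?_)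
  rw [Real.one_le_sqrt]
  linarith [Real.pi_gt_three]

/-- The Gaussian density at `max m 0` is controlled by the Gaussian tail at `m`. -/
lemma gaussianPDFReal_le_tail (m : ℝ) :
    gaussianPDFReal 0 1 (max m 0) ≤
      Real.exp (3 / 2) * (1 + max m 0) * (gaussianReal 0 1).real (Set.Ioi m) := by
  set p := max m 0
  have hp : 0 ≤ p := le_max_right _ _
  -- On `(p, p + h]` one has `x² ≤ p² + 2ph + h² ≤ p² + 3`, so the density there is at least
  -- `e^{-3/2}` times its value at `p`.
  set h : ℝ := 1 / (1 + p)
  have hh : 0 < h := by positivity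
  have hph : h * (1 + p) = 1 := by simp only [h]; field_simp
  have h1 : h ≤ 1 := by nlinarith
  have hlow : h * (gaussianPDFReal 0 1 p * Real.exp (-(3 / 2))) ≤
      (gaussianReal 0 1).real (Set.Ioi m) := by
    calc h * (gaussianPDFReal 0 1 p * Real.exp (-(3 / 2)))
        = ∫ x in Set.Ioc p (p + h), (gaussianPDFReal 0 1 p * Real.exp (-(3 / 2))) := by
          simp [hh.le]
      _ ≤ ∫ x in Set.Ioc p (p + h), gaussianPDFReal 0 1 x := by
          refine setIntegral_mono_on (integrable_const _) (integrable_gaussianPDFReal 0 1).integrableOn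
            measurableSet_Ioc fun x hx => ?_
          rw [gaussianPDFReal_zero_one, gaussianPDFReal_zero_one, mul_assoc, ← Real.exp_add]
          gcongr
          have : x ^ 2 ≤ (p + h) ^ 2 := by
            have := hx.1
            have := hx.2
            have : 0 ≤ x := by linarith
            gcongr
          nlinarith
      _ = (gaussianReal 0 1).real (Set.Ioc p (p + h)) := (measureReal_gaussianReal _).symm
      _ ≤ _ := measureReal_mono fun x hx => (le_max_left m 0).trans_lt hx.1
  have he : Real.exp (3 / 2) * Real.exp (-(3 / 2)) = 1 := by rw [← Real.exp_add]; simp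
  calc gaussianPDFReal 0 1 p
      = (Real.exp (3 / 2) * (1 + p)) * (h * (gaussianPDFReal 0 1 p * Real.exp (-(3 / 2)))) := by
        linear_combination (-gaussianPDFReal 0 1 p) * he -
          (gaussianPDFReal 0 1 p) * (Real.exp (3 / 2) * Real.exp (-(3 / 2))) * hph
    _ ≤ _ := by gcongr

/-- Gaussian measure of a short initial piece of an upper set. -/
lemma gaussianReal_upper_inter_Ioc_le {U : Set ℝ} (hU : IsUpperSet U) (b : ℝ) {δ L : ℝ}
    (hδ : 0 ≤ δ) (hL : 0 ≤ L) :
    (gaussianReal 0 1).real (U ∩ Set.Ioc b (b + δ)) ≤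
      δ * (Real.exp (-(L ^ 2) / 2) +
        Real.exp (3 / 2) * (1 + L) * (gaussianReal 0 1).real (U ∩ Set.Ioi b)) := by
  set W := U ∩ Set.Ioi b with hW
  rcases W.eq_empty_or_nonempty with he | hne
  · have : U ∩ Set.Ioc b (b + δ) = ∅ :=
      Set.subset_eq_empty (fun x hx => ⟨hx.1, hx.2.1⟩ : _ ⊆ W) he
    rw [this]
    simp only [measureReal_empty]
    positivity
  have hbdd : BddBelow W := ⟨b, fun x hx => hx.2.le⟩
  set m := sInf W
  have hbm : b ≤ m := le_csInf hne fun x hx => hx.2.le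
  have hIoi : Set.Ioi m ⊆ W := by
    intro x hx
    obtain ⟨w, hw, hwx⟩ := exists_lt_of_csInf_lt hne hx
    exact ⟨hU hwx.le hw.1, lt_trans hw.2 hwx⟩
  have hsub : U ∩ Set.Ioc b (b + δ) ⊆ Set.Icc m (m + δ) := fun x hx =>
    ⟨csInf_le hbdd ⟨hx.1, hx.2.1⟩, hx.2.2.trans (by linarith)⟩
  set p := max m 0 with hp
  have hup : (gaussianReal 0 1).real (U ∩ Set.Ioc b (b + δ)) ≤ δ * gaussianPDFReal 0 1 p := by
    calc (gaussianReal 0 1).real (U ∩ Set.Ioc b (b + δ))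
        ≤ (gaussianReal 0 1).real (Set.Icc m (m + δ)) := measureReal_mono hsub
      _ = ∫ x in Set.Icc m (m + δ), gaussianPDFReal 0 1 x := measureReal_gaussianReal _
      _ ≤ ∫ x in Set.Icc m (m + δ), gaussianPDFReal 0 1 p := by
          refine setIntegral_mono_on (integrable_gaussianPDFReal 0 1).integrableOn (integrable_const _)
            measurableSet_Icc fun x hx => gaussianPDFReal_le_of_sq_le ?_
          rcases max_cases m 0 with ⟨h, h'⟩ | ⟨h, h'⟩ <;> rw [hp, h]
          · have := hx.1
            gcongr
          · simpa using sq_nonneg x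
      _ = δ * gaussianPDFReal 0 1 p := by simp [hδ]
  refine hup.trans (mul_le_mul_of_nonneg_left ?_ hδ)
  have hp0 : 0 ≤ p := le_max_right _ _
  -- If the set begins beyond `L`, the density is at most `e^{-L²/2}`, small enough to be summed
  -- over all coordinates. Otherwise it is at most of order `1 + L` times the mass of the set, and
  -- such masses will be summed over disjoint events.
  rcases le_total L p with h | h
  · have h1 : gaussianPDFReal 0 1 p ≤ Real.exp (-(L ^ 2) / 2) := by
      refine (gaussianPDFReal_le_exp p).trans ?_
      gcongr
    have : 0 ≤ Real.exp (3 / 2) * (1 + L) * (gaussianReal 0 1).real W := by positivity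
    linarith
  · have h1 := gaussianPDFReal_le_tail m
    have h2 : Real.exp (3 / 2) * (1 + p) * (gaussianReal 0 1).real (Set.Ioi m) ≤
        Real.exp (3 / 2) * (1 + L) * (gaussianReal 0 1).real W := by
      have := measureReal_mono (μ := gaussianReal 0 1) hIoi
      gcongr
    have := Real.exp_pos (-(L ^ 2) / 2)
    linarith

variable {d : ℕ}

lemma measureReal_conv_map_smul (ρ : Measure (Fin d → ℝ)) [IsProbabilityMeasure ρ]
    (γ : Measure ℝ) [IsProbabilityMeasure γ] (c : Fin d → ℝ) {S : Set (Fin d → ℝ)}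
    (hS : MeasurableSet S) :
    Integrable (fun x => γ.real {ξ | x + ξ • c ∈ S}) ρ ∧
      (ρ.conv (γ.map fun ξ => ξ • c)).real S = ∫ x, γ.real {ξ | x + ξ • c ∈ S} ∂ρ := by
  have hm : Measurable fun p : (Fin d → ℝ) × ℝ => p.1 + p.2 • c := by fun_prop
  have hT := hm hS
  have hc : ρ.conv (γ.map fun ξ => ξ • c) = (ρ.prod γ).map fun p => p.1 + p.2 • c := by
    have : ρ.prod (γ.map fun ξ => ξ • c) = (ρ.prod γ).map (Prod.map id fun ξ => ξ • c) := by
      rw [← Measure.map_prod_map _ _ measurable_id (by fun_prop), Measure.map_id]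
    rw [Measure.conv, this, Measure.map_map (by fun_prop) (by fun_prop)]
    rfl
  have hmeas : Measurable fun x => γ {ξ | x + ξ • c ∈ S} := measurable_measure_prodMk_left hT
  constructor
  · refine Integrable.mono' (integrable_const (1 : ℝ)) hmeas.ennreal_toReal.aestronglyMeasurable
      (ae_of_all _ fun x => ?_)
    rw [Real.norm_of_nonneg measureReal_nonneg]
    exact measureReal_le_one
  · rw [hc, measureReal_def, Measure.map_apply hm hS, Measure.prod_apply hT]
    simp only [measureReal_def]
    rw [integral_toReal hmeas.aemeasurable (ae_of_all _ fun x => measure_lt_top _ _)]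
    rfl

/-- Decomposition of a centred Gaussian vector into its part along one coordinate and an
independent part in which this coordinate vanishes. -/
lemma HasGaussianCharFun.exists_conv_eq {ρ : Measure (Fin d → ℝ)} [IsProbabilityMeasure ρ]
    {V : Matrix (Fin d) (Fin d) ℝ} (h : HasGaussianCharFun ρ V) (hV : V.PosSemidef) (j : Fin d)
    (hj : 0 < V j j) :
    ∃ ρ' : Measure (Fin d → ℝ), IsProbabilityMeasure ρ' ∧ (∀ᵐ x ∂ρ', x j = 0) ∧
      ρ = ρ'.conv ((gaussianReal 0 1).map fun ξ => ξ • fun k => V k j / √(V j j)) := by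
  set c : Fin d → ℝ := fun k => V k j / V j j with hc
  -- `A x = x - x_j c` is the residual of the regression on coordinate `j`. The decomposition
  -- amounts to `A V Aᵀ + V_jj c cᵀ = V`.
  set A : Matrix (Fin d) (Fin d) ℝ := 1 - Matrix.vecMulVec c (Pi.single j 1) with hA
  have hAm : Measurable A.mulVec := (Matrix.mulVecLin A).continuous_of_finiteDimensional.measurable
  have hAx : ∀ x, A.mulVec x j = 0 := by
    intro x
    simp [hA, Matrix.sub_mulVec, Matrix.vecMulVec_mulVec, hc, hj.ne']
  have hm2 : Measurable fun ξ : ℝ => ξ • fun k => V k j / √(V j j) := by fun_prop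
  have hP : IsProbabilityMeasure (ρ.map A.mulVec) :=
    Measure.isProbabilityMeasure_map hAm.aemeasurable
  have hP2 : IsProbabilityMeasure ((gaussianReal 0 1).map fun ξ => ξ • fun k => V k j / √(V j j)) :=
    Measure.isProbabilityMeasure_map hm2.aemeasurable
  refine ⟨ρ.map A.mulVec, hP, ?_, h.ext ?_⟩
  · rw [ae_map_iff hAm.aemeasurable (measurableSet_eq_fun (by fun_prop) (by fun_prop))]
    exact ae_of_all _ hAx
  · have := (h.map_mulVec A).conv (hasGaussianCharFun_map_smul 1 fun k => V k j / √(V j j))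
    convert this using 1
    ext k l
    have hs : V j l = V l j := by
      have := hV.isHermitian.apply l j
      simpa using this
    have hsq : √(V j j) * √(V j j) = V j j := Real.mul_self_sqrt hj.le
    simp only [hA, Matrix.sub_mul, Matrix.mul_sub, Matrix.mul_one,
      Matrix.transpose_sub, Matrix.transpose_one, Matrix.transpose_vecMulVec,
      Matrix.vecMulVec_mul, Matrix.mul_vecMulVec, Matrix.add_apply, Matrix.sub_apply,
      Matrix.vecMulVec_apply, Matrix.smul_apply, Matrix.single_one_vecMul, Matrix.mulVec_single_one,
      Matrix.row_apply, Matrix.col_apply, hc, smul_eq_mul, NNReal.coe_one, one_mul, hs,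
      div_mul_div_comm, hsq]
    field_simp
    ring

/-- `j` is the first index at which `(x k - r) / σ k` is maximal. -/
def firstArgmax (σ : Fin d → ℝ) (r : ℝ) (j : Fin d) : Set (Fin d → ℝ) :=
  {x | ∀ k, (x k - r) / σ k ≤ (x j - r) / σ j ∧ (k < j → (x k - r) / σ k < (x j - r) / σ j)}

lemma measurableSet_firstArgmax (σ : Fin d → ℝ) (r : ℝ) (j : Fin d) :
    MeasurableSet (firstArgmax σ r j) := by
  have e : firstArgmax σ r j = ⋂ k, ({x | (x k - r) / σ k ≤ (x j - r) / σ j} ∩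
      ⋂ _ : k < j, {x | (x k - r) / σ k < (x j - r) / σ j}) := by
    ext x
    simp [firstArgmax]
  rw [e]
  exact MeasurableSet.iInter fun k => (measurableSet_le (by fun_prop) (by fun_prop)).inter
    (MeasurableSet.iInter fun _ => measurableSet_lt (by fun_prop) (by fun_prop))

/-- Breaking ties by the smallest index makes the events disjoint, so their probabilities sum to at
most `1` whatever `d` is. -/
lemma firstArgmax_disjoint (σ : Fin d → ℝ) (r : ℝ) :
    Pairwise fun i j => Disjoint (firstArgmax σ r i) (firstArgmax σ r j) := by
  intro i j hij
  rw [Set.disjoint_left]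
  intro x hi hj
  rcases lt_or_gt_of_ne hij with h | h
  · exact absurd ((hj i).2 h) (not_lt.2 (hi j).1)
  · exact absurd ((hi j).2 h) (not_lt.2 (hj i).1)

lemma exists_mem_firstArgmax (hd : 0 < d) (σ : Fin d → ℝ) (r : ℝ) (x : Fin d → ℝ) :
    ∃ j, x ∈ firstArgmax σ r j := by
  classical
  have hne : (Finset.univ : Finset (Fin d)).Nonempty := ⟨⟨0, hd⟩, Finset.mem_univ _⟩
  obtain ⟨j₀, -, hj₀⟩ := Finset.exists_max_image Finset.univ (fun k => (x k - r) / σ k) hne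
  set s := Finset.univ.filter fun j => ∀ k, (x k - r) / σ k ≤ (x j - r) / σ j with hs
  have hsne : s.Nonempty := ⟨j₀, by simp [hs]; exact fun k => hj₀ k (Finset.mem_univ k)⟩
  refine ⟨s.min' hsne, fun k => ?_⟩
  have hmem := s.min'_mem hsne
  simp only [hs, Finset.mem_filter, Finset.mem_univ, true_and] at hmem
  refine ⟨hmem k, fun hk => lt_of_le_of_ne (hmem k) fun heq => ?_⟩
  have : k ∈ s := by
    simp only [hs, Finset.mem_filter, Finset.mem_univ, true_and]
    intro l
    rw [heq]
    exact hmem l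
  exact absurd (s.min'_le k this) (not_le.2 hk)

/-- A correlation is at most `1`: evaluate the quadratic form at `√V_jj e_k - √V_kk e_j`. -/
lemma PosSemidef.entry_le (V : Matrix (Fin d) (Fin d) ℝ) (hV : V.PosSemidef) {j k : Fin d}
    (hj : 0 < V j j) (hk : 0 < V k k) : V k j / √(V j j) / √(V k k) ≤ 1 := by
  have hs : V j k = V k j := by
    have := hV.isHermitian.apply k j
    simpa using this
  have h := PosSemidef.dotProduct_nonneg hV
    (√(V j j) • (Pi.single k 1 : Fin d → ℝ) - √(V k k) • (Pi.single j 1 : Fin d → ℝ))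
  simp only [sub_dotProduct, Matrix.mulVec_sub, dotProduct_sub, smul_dotProduct,
    Matrix.mulVec_smul, dotProduct_smul, single_dotProduct_mulVec_single, smul_eq_mul, hs] at h
  have h1 : √(V j j) * √(V j j) = V j j := Real.mul_self_sqrt hj.le
  have h2 : √(V k k) * √(V k k) = V k k := Real.mul_self_sqrt hk.le
  have p1 := Real.sqrt_pos.2 hj
  have p2 := Real.sqrt_pos.2 hk
  rw [div_div, div_le_one (by positivity)]
  have h3 : (√(V j j) * √(V k k)) * V k j ≤ (√(V j j) * √(V k k)) * (√(V j j) * √(V k k)) := by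
    rw [← h1, ← h2] at h
    simp only [Real.sqrt_mul_self p1.le, Real.sqrt_mul_self p2.le] at h
    nlinarith
  exact le_of_mul_le_mul_left h3 (by positivity)

/-- Fix the residual `x` and move along `x + ξ c`. The normalised coordinate `j` grows at rate `1`
and every other one at a rate equal to a correlation, hence at most `1`. So once `j` is the argmax
it remains so, the set of such `ξ` is an upper set, and the one-dimensional estimate applies for
each `x`. -/
lemma HasGaussianCharFun.measureReal_firstArgmax_inter_le {ρ : Measure (Fin d → ℝ)}
    [IsProbabilityMeasure ρ] {V : Matrix (Fin d) (Fin d) ℝ} (h : HasGaussianCharFun ρ V)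
    (hV : V.PosSemidef) (hpos : ∀ k, 0 < V k k) (r : ℝ) {δ L : ℝ} (hδ : 0 ≤ δ) (hL : 0 ≤ L)
    (j : Fin d) :
    ρ.real (firstArgmax (fun k => √(V k k)) r j ∩ {x | r < x j ∧ x j ≤ r + δ}) ≤
      (δ / √(V j j)) * (Real.exp (-(L ^ 2) / 2) + Real.exp (3 / 2) * (1 + L) *
        ρ.real (firstArgmax (fun k => √(V k k)) r j ∩ {x | r < x j})) := by
  obtain ⟨ρ', hρ', hz, hconv⟩ := h.exists_conv_eq hV j (hpos j)
  set c : Fin d → ℝ := fun k => V k j / √(V j j) with hc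
  set σ : Fin d → ℝ := fun k => √(V k k) with hσ
  have hσpos : ∀ k, 0 < σ k := fun k => Real.sqrt_pos.2 (hpos k)
  have hcj : c j = σ j := by
    simp only [hc, hσ]
    rw [div_eq_iff (hσpos j).ne', Real.mul_self_sqrt (hpos j).le]
  have hrate : ∀ k, c k / σ k ≤ 1 := fun k => PosSemidef.entry_le V hV (hpos j) (hpos k)
  have hA := measurableSet_firstArgmax σ r j
  have hS1 : MeasurableSet (firstArgmax σ r j ∩ {x | r < x j ∧ x j ≤ r + δ}) :=
    hA.inter (measurableSet_Ioc.preimage (measurable_pi_apply j))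
  have hS2 : MeasurableSet (firstArgmax σ r j ∩ {x | r < x j}) :=
    hA.inter (measurableSet_lt (by fun_prop) (by fun_prop))
  obtain ⟨i1, e1⟩ := measureReal_conv_map_smul ρ' (gaussianReal 0 1) c hS1
  obtain ⟨i2, e2⟩ := measureReal_conv_map_smul ρ' (gaussianReal 0 1) c hS2
  rw [← hconv] at e1 e2
  have key : ∀ᵐ x ∂ρ',
      (gaussianReal 0 1).real {ξ | x + ξ • c ∈ firstArgmax σ r j ∩ {x | r < x j ∧ x j ≤ r + δ}} ≤
      (δ / σ j) * (Real.exp (-(L ^ 2) / 2) + Real.exp (3 / 2) * (1 + L) *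
        (gaussianReal 0 1).real {ξ | x + ξ • c ∈ firstArgmax σ r j ∩ {x | r < x j}}) := by
    filter_upwards [hz] with x hx
    have hU : IsUpperSet {ξ : ℝ | x + ξ • c ∈ firstArgmax σ r j} := by
      intro a b hab ha k
      have hmove : ∀ k, (x k + b * c k - r) / σ k = (x k + a * c k - r) / σ k +
          (b - a) * (c k / σ k) := by intro k; field_simp; ring
      have hk := ha k
      simp only [Pi.add_apply, Pi.smul_apply, smul_eq_mul] at hk ⊢
      have hj1 : c j / σ j = 1 := by rw [hcj, div_self (hσpos j).ne']
      rw [hmove k, hmove j, hj1]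
      have := mul_le_mul_of_nonneg_left (hrate k) (sub_nonneg.2 hab)
      exact ⟨by linarith [hk.1], fun hlt => by linarith [hk.2 hlt]⟩
    have s1 : {ξ | x + ξ • c ∈ firstArgmax σ r j ∩ {x | r < x j ∧ x j ≤ r + δ}} =
        {ξ : ℝ | x + ξ • c ∈ firstArgmax σ r j} ∩ Set.Ioc (r / σ j) (r / σ j + δ / σ j) := by
      ext ξ
      simp only [Set.mem_ofPred_eq, Set.mem_inter_iff, Set.mem_Ioc, Pi.add_apply, Pi.smul_apply,
        smul_eq_mul, hx, zero_add, hcj, ← add_div, div_lt_iff₀ (hσpos j), le_div_iff₀ (hσpos j)]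
    have s2 : {ξ | x + ξ • c ∈ firstArgmax σ r j ∩ {x | r < x j}} =
        {ξ : ℝ | x + ξ • c ∈ firstArgmax σ r j} ∩ Set.Ioi (r / σ j) := by
      ext ξ
      simp only [Set.mem_ofPred_eq, Set.mem_inter_iff, Set.mem_Ioi, Pi.add_apply, Pi.smul_apply,
        smul_eq_mul, hx, zero_add, hcj, div_lt_iff₀ (hσpos j)]
    rw [s1, s2]
    exact gaussianReal_upper_inter_Ioc_le hU _ (div_nonneg hδ (hσpos j).le) hL
  rw [e1, e2]
  refine (integral_mono_ae i1 ?_ key).trans (le_of_eq ?_)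
  · exact ((integrable_const _).add (i2.const_mul _)).const_mul _
  · rw [integral_const_mul, integral_add (integrable_const _) (i2.const_mul _), integral_const_mul]
    simp only [integral_const, probReal_univ, smul_eq_mul, one_mul]
    rfl

/-- Nazarov's anti-concentration inequality for the maximum of a centred Gaussian vector. -/
theorem HasGaussianCharFun.anticoncentration {ρ : Measure (Fin d → ℝ)}
    [IsProbabilityMeasure ρ] {V : Matrix (Fin d) (Fin d) ℝ} (h : HasGaussianCharFun ρ V)
    (hV : V.PosSemidef) (hd : 1 < d) {v : ℝ} (hv : 0 < v) (hvV : ∀ k, v ^ 2 ≤ V k k) (r : ℝ)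
    {δ : ℝ} (hδ : 0 ≤ δ) :
    ρ.real {x | r < maxCoord x ∧ maxCoord x ≤ r + δ} ≤
      (δ / v) * (1 + Real.exp (3 / 2) * (1 + √(2 * Real.log d))) := by
  have : Nonempty (Fin d) := ⟨⟨0, by omega⟩⟩
  have hpos : ∀ k, 0 < V k k := fun k => lt_of_lt_of_le (by positivity) (hvV k)
  -- Chosen so that `e^{-L²/2} = 1/d`: the `d` far terms sum to `1`.
  set L := √(2 * Real.log d)
  have hd0 : (0 : ℝ) < d := by positivity
  have hexpL : Real.exp (-(L ^ 2) / 2) = 1 / d := by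
    rw [Real.sq_sqrt (by positivity)]
    have : -(2 * Real.log d) / 2 = -Real.log d := by ring
    rw [this, Real.exp_neg, Real.exp_log hd0, one_div]
  set A := fun j => firstArgmax (fun k => √(V k k)) r j with hA
  have hcover : {x : Fin d → ℝ | r < maxCoord x ∧ maxCoord x ≤ r + δ} ⊆
      ⋃ j, (A j ∩ {x | r < x j ∧ x j ≤ r + δ}) := by
    rintro x ⟨hx1, hx2⟩
    obtain ⟨j, hj⟩ := exists_mem_firstArgmax (by omega) (fun k => √(V k k)) r x
    refine Set.mem_iUnion.2 ⟨j, hj, ?_, ?_⟩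
    -- The index `j` maximises `(x_k - r) / σ_k`, not `x_k`. Still, some positive `x_k - r` forces
    -- `x_j - r` to be positive.
    · obtain ⟨k, hk⟩ := exists_lt_of_lt_ciSup hx1
      have h1 : 0 < (x k - r) / √(V k k) := div_pos (sub_pos.2 hk) (Real.sqrt_pos.2 (hpos k))
      have h2 := h1.trans_le (hj k).1
      have := (div_pos_iff_of_pos_right (Real.sqrt_pos.2 (hpos j))).1 h2
      linarith
    · exact (le_ciSup (f := fun j => x j) (Set.finite_range _).bddAbove j).trans hx2
  have hdis : ∑ j, ρ.real (A j ∩ {x | r < x j}) ≤ 1 := by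
    rw [← measureReal_iUnion_fintype]
    · exact measureReal_le_one
    · intro i j hij
      exact ((firstArgmax_disjoint _ r hij).mono Set.inter_subset_left Set.inter_subset_left)
    · intro j
      exact (measurableSet_firstArgmax _ r j).inter (measurableSet_lt (by fun_prop) (by fun_prop))
  have hL : 0 ≤ L := Real.sqrt_nonneg _
  calc ρ.real {x | r < maxCoord x ∧ maxCoord x ≤ r + δ}
      ≤ ρ.real (⋃ j, (A j ∩ {x | r < x j ∧ x j ≤ r + δ})) := measureReal_mono hcover
    _ ≤ ∑ j, ρ.real (A j ∩ {x | r < x j ∧ x j ≤ r + δ}) := measureReal_iUnion_fintype_le _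
    _ ≤ ∑ j, (δ / v) * (1 / d + Real.exp (3 / 2) * (1 + L) * ρ.real (A j ∩ {x | r < x j})) := by
        refine Finset.sum_le_sum fun j _ => ?_
        refine (h.measureReal_firstArgmax_inter_le hV hpos r hδ hL j).trans ?_
        rw [hexpL]
        have : v ≤ √(V j j) := Real.le_sqrt_of_sq_le (hvV j)
        gcongr
    _ = (δ / v) * (1 + Real.exp (3 / 2) * (1 + L) * ∑ j, ρ.real (A j ∩ {x | r < x j})) := by
        rw [← Finset.mul_sum, Finset.sum_add_distrib, ← Finset.mul_sum]
        simp [hd0.ne']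
    _ ≤ (δ / v) * (1 + Real.exp (3 / 2) * (1 + L) * 1) := by gcongr
    _ = _ := by rw [mul_one]

end MDSBerryEsseen

/-! ### Smooth approximation of the indicator of `{M ≤ r}` by log-sum-exp. -/

namespace MDSBerryEsseen

/-- Second order Taylor expansion with bounded measurable coefficients and remainder
`K ‖x‖_∞³`, uniformly in the base point. -/
def HasTaylor {d : ℕ} (f : (Fin d → ℝ) → ℝ) (K : ℝ) : Prop :=
  ∃ (G : (Fin d → ℝ) → Fin d → ℝ) (H : (Fin d → ℝ) → Fin d → Fin d → ℝ) (B : ℝ),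
    Measurable f ∧ (∀ j, Measurable fun s => G s j) ∧ (∀ j k, Measurable fun s => H s j k) ∧
    (∀ s, |f s| ≤ B) ∧ (∀ s j, |G s j| ≤ B) ∧ (∀ s j k, |H s j k| ≤ B) ∧
    ∀ s x, |f (s + x) - (f s + ∑ j, G s j * x j + 1 / 2 * ∑ j, ∑ k, H s j k * (x j * x k))|
      ≤ K * ‖x‖ ^ 3

/-- A smooth non-increasing step from `1` to `0` on `[0, 1]`, with bounded derivatives. -/
lemma exists_smooth_step : ∃ (g : ℕ → ℝ → ℝ) (K : ℝ), 0 < K ∧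
    (∀ i u, HasDerivAt (g i) (g (i + 1) u) u) ∧ (∀ i ≤ 3, ∀ u, |g i u| ≤ K) ∧
    (∀ u, 0 ≤ g 0 u ∧ g 0 u ≤ 1) ∧ (∀ u ≤ 0, g 0 u = 1) ∧ (∀ u, 1 ≤ u → g 0 u = 0) := by
  set φ : ℝ → ℝ := fun u => Real.smoothTransition (1 - u) with hφ
  have hs : ContDiff ℝ ((⊤ : ℕ∞) : WithTop ℕ∞) φ := Real.smoothTransition.contDiff.comp (contDiff_const.sub contDiff_id)
  have hcont : ∀ i : ℕ, Continuous (iteratedDeriv i φ) := fun i =>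
    hs.continuous_iteratedDeriv i (by exact_mod_cast le_top)
  have hone : ∀ u ≤ 0, φ u = 1 := fun u hu =>
    Real.smoothTransition.one_of_one_le (by linarith)
  have hzero : ∀ u, 1 ≤ u → φ u = 0 := fun u hu =>
    Real.smoothTransition.zero_of_nonpos (by linarith)
  have hout : ∀ i : ℕ, 0 < i → ∀ u, u ∉ Set.Icc (0 : ℝ) 1 → iteratedDeriv i φ u = 0 := by
    intro i hi u hu
    rw [Set.mem_Icc, not_and_or, not_le, not_le] at hu
    rcases hu with hu | hu
    · have : φ =ᶠ[𝓝 u] fun _ => 1 := by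
        filter_upwards [Iio_mem_nhds hu] with y hy using hone y (le_of_lt hy)
      rw [this.iteratedDeriv_eq]
      simp [iteratedDeriv_const, hi.ne']
    · have : φ =ᶠ[𝓝 u] fun _ => 0 := by
        filter_upwards [Ioi_mem_nhds hu] with y hy using hzero y (le_of_lt hy)
      rw [this.iteratedDeriv_eq]
      simp
  have hbd : ∀ i : ℕ, ∃ K, ∀ u, |iteratedDeriv i φ u| ≤ K := by
    intro i
    obtain ⟨K, hK⟩ := isCompact_Icc.exists_bound_of_continuousOn
      (hcont i).continuousOn (s := Set.Icc (0 : ℝ) 1)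
    refine ⟨max K 1, fun u => ?_⟩
    by_cases hu : u ∈ Set.Icc (0 : ℝ) 1
    · exact (hK u hu).trans (le_max_left _ _)
    · rcases Nat.eq_zero_or_pos i with rfl | hi
      · rw [iteratedDeriv_zero, abs_of_nonneg (Real.smoothTransition.nonneg _)]
        exact (Real.smoothTransition.le_one _).trans (le_max_right _ _)
      · rw [hout i hi u hu]
        simp
  choose K hK using hbd
  refine ⟨fun i => iteratedDeriv i φ, 1 + |K 0| + |K 1| + |K 2| + |K 3|, by positivity, ?_, ?_, ?_,
    ?_, ?_⟩
  · intro i u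
    beta_reduce
    rw [iteratedDeriv_succ]
    exact (hs.differentiable_iteratedDeriv i (by exact_mod_cast WithTop.coe_lt_top i)
      u).hasDerivAt
  · intro i hi u
    refine (hK i u).trans ((le_abs_self _).trans ?_)
    have := abs_nonneg (K 0)
    have := abs_nonneg (K 1)
    have := abs_nonneg (K 2)
    have := abs_nonneg (K 3)
    interval_cases i <;> linarith
  · intro u
    beta_reduce
    rw [iteratedDeriv_zero]
    exact ⟨Real.smoothTransition.nonneg _, Real.smoothTransition.le_one _⟩
  · simpa using hone
  · simpa using hzero

/-- Three successive mean value estimates on `[0, 1]`, each for a function whose derivative was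
bounded by the one before. The sharp factor `1/6` is not needed. -/
lemma abs_taylor_two_le {h h1 h2 h3 : ℝ → ℝ} (d0 : ∀ t, HasDerivAt h (h1 t) t)
    (d1 : ∀ t, HasDerivAt h1 (h2 t) t) (d2 : ∀ t, HasDerivAt h2 (h3 t) t) {K : ℝ}
    (hK : ∀ t, |h3 t| ≤ K) : |h 1 - (h 0 + h1 0 + 1 / 2 * h2 0)| ≤ K := by
  have hK0 : 0 ≤ K := (abs_nonneg _).trans (hK 0)
  have mvt : ∀ {φ φ' : ℝ → ℝ}, (∀ t, HasDerivAt φ (φ' t) t) →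
      (∀ t ∈ Set.Icc (0 : ℝ) 1, |φ' t| ≤ K) → ∀ t ∈ Set.Icc (0 : ℝ) 1, |φ t - φ 0| ≤ K := by
    intro φ φ' hφ hb t ht
    have := norm_image_sub_le_of_norm_deriv_le_segment_01' (f := fun s => φ (t * s))
      (f' := fun s => φ' (t * s) * t) (C := K) (fun s _ => ?_) (fun s hs => ?_)
    · simpa using this
    · have h1 : HasDerivAt (fun s : ℝ => t * s) t s := by
        simpa using (hasDerivAt_id s).const_mul t
      exact ((hφ (t * s)).comp s h1).hasDerivWithinAt
    · rw [norm_mul]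
      have h1 := hb (t * s) ⟨mul_nonneg ht.1 hs.1, mul_le_one₀ ht.2 hs.1 hs.2.le⟩
      calc ‖φ' (t * s)‖ * ‖t‖ ≤ K * 1 := by
            have : ‖t‖ ≤ 1 := by rw [Real.norm_of_nonneg ht.1]; exact ht.2
            gcongr
            exact h1
        _ = K := mul_one K
  have s2 := mvt d2 fun t _ => hK t
  have s1 := mvt (φ := fun t => h1 t - t * h2 0) (φ' := fun t => h2 t - h2 0)
    (fun t => ((d1 t).fun_sub ((hasDerivAt_id t).mul_const (h2 0))).congr_deriv (by simp)) s2
  have s0 := mvt (φ := fun t => h t - t * h1 0 - 1 / 2 * t ^ 2 * h2 0)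
    (φ' := fun t => h1 t - t * h2 0 - h1 0) (fun t => by
      have e1 := ((hasDerivAt_id t).mul_const (h1 0))
      have e2 := (((hasDerivAt_pow 2 t).const_mul (1 / 2 : ℝ)).mul_const (h2 0))
      refine (((d0 t).fun_sub e1).fun_sub e2).congr_deriv ?_
      simp
      ring) (fun t ht => by simpa using s1 t ht) 1 (by simp)
  convert s0 using 2
  simp
  ring

section LogSumExp

variable {d : ℕ}

/-- `∑_j x_j^k e^{β (s_j + t x_j)}`. -/
noncomputable def expSum (β : ℝ) (s x : Fin d → ℝ) (k : ℕ) (t : ℝ) : ℝ :=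
  ∑ j, x j ^ k * Real.exp (β * (s j + t * x j))

/-- Moments of `x` under the Gibbs weights at `s + t x`. -/
noncomputable def gibbsMoment (β : ℝ) (s x : Fin d → ℝ) (k : ℕ) (t : ℝ) : ℝ :=
  expSum β s x k t / expSum β s x 0 t

/-- The smooth maximum `β⁻¹ log ∑_j e^{β s_j}`. -/
noncomputable def smoothMax (β : ℝ) (s : Fin d → ℝ) : ℝ := β⁻¹ * Real.log (∑ j, Real.exp (β * s j))

/-- Gibbs weights. -/
noncomputable def gibbs (β : ℝ) (s : Fin d → ℝ) (j : Fin d) : ℝ :=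
  Real.exp (β * s j) / ∑ k, Real.exp (β * s k)

variable {β : ℝ} {s x : Fin d → ℝ}

lemma expSum_zero_pos [Nonempty (Fin d)] (t : ℝ) : 0 < expSum β s x 0 t :=
  Finset.sum_pos (fun j _ => by positivity) Finset.univ_nonempty

lemma hasDerivAt_expSum (k : ℕ) (t : ℝ) :
    HasDerivAt (expSum β s x k) (β * expSum β s x (k + 1) t) t := by
  unfold expSum
  rw [Finset.mul_sum]
  refine HasDerivAt.fun_sum fun j _ => ?_
  have h1 : HasDerivAt (fun t : ℝ => β * (s j + t * x j)) (β * x j) t := by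
    simpa using (((hasDerivAt_id t).mul_const (x j)).const_add (s j)).const_mul β
  refine (h1.exp.const_mul (x j ^ k)).congr_deriv ?_
  ring

/-- The derivative is `β` times a Gibbs covariance. Moments are thus closed under differentiation,
and directional derivatives are bounded by powers of `β` and `‖x‖` with no further dependence on
`d`. -/
lemma hasDerivAt_gibbsMoment [Nonempty (Fin d)] (k : ℕ) (t : ℝ) :
    HasDerivAt (gibbsMoment β s x k)
      (β * (gibbsMoment β s x (k + 1) t - gibbsMoment β s x k t * gibbsMoment β s x 1 t)) t := by
  have h0 : expSum β s x 0 t ≠ 0 := (expSum_zero_pos t).ne'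
  refine ((hasDerivAt_expSum (β := β) (s := s) (x := x) k t).fun_div
    (hasDerivAt_expSum 0 t) h0).congr_deriv ?_
  simp only [gibbsMoment]
  field_simp

lemma hasDerivAt_smoothMax [Nonempty (Fin d)] (hβ : β ≠ 0) (t : ℝ) :
    HasDerivAt (fun t : ℝ => smoothMax β (s + t • x)) (gibbsMoment β s x 1 t) t := by
  have h0 : expSum β s x 0 t ≠ 0 := (expSum_zero_pos t).ne'
  have h := ((hasDerivAt_expSum (β := β) (s := s) (x := x) 0 t).log h0).const_mul β⁻¹
  have e : (fun t : ℝ => smoothMax β (s + t • x)) =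
      fun t => β⁻¹ * Real.log (expSum β s x 0 t) := by
    ext u
    simp [smoothMax, expSum]
  rw [e]
  refine h.congr_deriv ?_
  simp only [gibbsMoment]
  field_simp

lemma abs_gibbsMoment_le [Nonempty (Fin d)] (k : ℕ) (t : ℝ) :
    |gibbsMoment β s x k t| ≤ ‖x‖ ^ k := by
  have h0 := expSum_zero_pos (β := β) (s := s) (x := x) t
  rw [gibbsMoment, abs_div, abs_of_pos h0, div_le_iff₀ h0]
  unfold expSum
  rw [Finset.mul_sum]
  refine (Finset.abs_sum_le_sum_abs _ _).trans (Finset.sum_le_sum fun j _ => ?_)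
  rw [abs_mul, abs_pow, Real.abs_exp, pow_zero, one_mul]
  have : |x j| ≤ ‖x‖ := norm_le_pi_norm x j
  gcongr

lemma gibbsMoment_zero (k : ℕ) : gibbsMoment β s x k 0 = ∑ j, gibbs β s j * x j ^ k := by
  simp only [gibbsMoment, expSum, gibbs, Finset.sum_div]
  refine Finset.sum_congr rfl fun j _ => ?_
  simp
  ring

lemma gibbs_nonneg (j : Fin d) : 0 ≤ gibbs β s j := by unfold gibbs; positivity

lemma gibbs_le_one (j : Fin d) : gibbs β s j ≤ 1 := by
  unfold gibbs
  refine div_le_one_of_le₀ ?_ (by positivity)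
  exact Finset.single_le_sum (f := fun k => Real.exp (β * s k)) (fun k _ => by positivity)
    (Finset.mem_univ j)

lemma measurable_gibbs (j : Fin d) : Measurable fun s => gibbs β s j := by
  unfold gibbs
  fun_prop

lemma measurable_smoothMax : Measurable fun s : Fin d → ℝ => smoothMax β s := by
  unfold smoothMax
  fun_prop

lemma maxCoord_le_smoothMax [Nonempty (Fin d)] (hβ : 0 < β) : maxCoord s ≤ smoothMax β s := by
  refine ciSup_le fun j => ?_
  rw [smoothMax, inv_mul_eq_div, le_div_iff₀ hβ, mul_comm]
  rw [Real.le_log_iff_exp_le (Finset.sum_pos (fun j _ => by positivity) Finset.univ_nonempty)]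
  exact Finset.single_le_sum (f := fun k => Real.exp (β * s k)) (fun k _ => by positivity)
    (Finset.mem_univ j)

lemma smoothMax_le [Nonempty (Fin d)] (hβ : 0 < β) :
    smoothMax β s ≤ maxCoord s + Real.log d / β := by
  have hd : (0 : ℝ) < d := by
    have : 0 < d := Fin.pos (Classical.arbitrary _)
    exact_mod_cast this
  have h1 : ∑ j, Real.exp (β * s j) ≤ d * Real.exp (β * maxCoord s) := by
    have : ∀ j ∈ Finset.univ, Real.exp (β * s j) ≤ Real.exp (β * maxCoord s) := fun j _ => by
      have : s j ≤ maxCoord s := le_ciSup (f := fun j => s j) (Set.finite_range _).bddAbove j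
      gcongr
    simpa using Finset.sum_le_card_nsmul _ _ _ this
  have h2 := Real.log_le_log (Finset.sum_pos (fun j _ => by positivity) Finset.univ_nonempty) h1
  rw [Real.log_mul hd.ne' (Real.exp_pos _).ne', Real.log_exp] at h2
  rw [smoothMax, inv_mul_eq_div, div_le_iff₀ hβ, add_mul, div_mul_cancel₀ _ hβ.ne']
  linarith

/-- Composition of a smooth function of one variable with the smooth maximum. -/
lemma hasTaylor_comp_smoothMax [Nonempty (Fin d)] (hβ : 0 < β) {g : ℕ → ℝ → ℝ}
    (hg : ∀ i u, HasDerivAt (g i) (g (i + 1) u) u) {K : ℕ → ℝ}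
    (hK : ∀ i ≤ 3, ∀ u, |g i u| ≤ K i) :
    HasTaylor (fun s : Fin d → ℝ => g 0 (smoothMax β s))
      (K 3 + 6 * K 2 * β + 6 * K 1 * β ^ 2) := by
  have hK0 : ∀ i ≤ 3, 0 ≤ K i := fun i hi => (abs_nonneg _).trans (hK i hi 0)
  have hgm : ∀ i, Measurable (g i) := fun i =>
    (continuous_iff_continuousAt.2 fun u => (hg i u).continuousAt).measurable
  have hm := measurable_smoothMax (d := d) (β := β)
  have hgib := fun j => measurable_gibbs (d := d) (β := β) j
  set A : (Fin d → ℝ) → ℝ := fun s => g 1 (smoothMax β s)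
  set E : (Fin d → ℝ) → ℝ := fun s => g 2 (smoothMax β s)
  have hA : ∀ s, |A s| ≤ K 1 := fun s => hK 1 (by norm_num) _
  have hE : ∀ s, |E s| ≤ K 2 := fun s => hK 2 (by norm_num) _
  have hp1 : ∀ (s : Fin d → ℝ) j, |gibbs β s j| ≤ 1 := fun s j => by
    rw [abs_of_nonneg (gibbs_nonneg j)]; exact gibbs_le_one j
  -- The gradient and Hessian from the chain rule, using that the Gibbs weights `p` satisfy `∂_k p_j
  -- = β (1_{j = k} p_j - p_j p_k)`.
  refine ⟨fun s j => A s * gibbs β s j,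
    fun s j k => (E s - β * A s) * (gibbs β s j * gibbs β s k) +
      if j = k then β * A s * gibbs β s j else 0,
    K 0 + K 1 + (K 2 + 2 * β * K 1), (hgm 0).comp hm, fun j => ((hgm 1).comp hm).mul (hgib j), ?_,
    ?_, ?_, ?_, ?_⟩
  · intro j k
    refine Measurable.add ((((hgm 2).comp hm).sub (((hgm 1).comp hm).const_mul β)).mul
      ((hgib j).mul (hgib k))) ?_
    split_ifs
    · exact (((hgm 1).comp hm).const_mul β).mul (hgib j)
    · exact measurable_const
  · intro s
    have := hK 0 (by norm_num) (smoothMax β s)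
    have := hK0 1 (by norm_num)
    have := hK0 2 (by norm_num)
    have : 0 ≤ 2 * β * K 1 := by positivity
    linarith
  · intro s j
    rw [abs_mul]
    have h1 : |A s| * |gibbs β s j| ≤ K 1 * 1 :=
      mul_le_mul (hA s) (hp1 s j) (abs_nonneg _) (hK0 1 (by norm_num))
    have := hK0 0 (by norm_num)
    have := hK0 1 (by norm_num)
    have := hK0 2 (by norm_num)
    have : 0 ≤ 2 * β * K 1 := by positivity
    linarith
  · intro s j k
    have k0 := hK0 0 (by norm_num)
    have k1 := hK0 1 (by norm_num)
    have k2 := hK0 2 (by norm_num)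
    have e1 : |E s - β * A s| ≤ K 2 + β * K 1 := by
      refine (abs_sub _ _).trans ?_
      rw [abs_mul, abs_of_pos hβ]
      have := hA s
      have := hE s
      gcongr
    have e2 : |gibbs β s j * gibbs β s k| ≤ 1 := by
      rw [abs_mul]
      exact mul_le_one₀ (hp1 s j) (abs_nonneg _) (hp1 s k)
    have e3 : |if j = k then β * A s * gibbs β s j else 0| ≤ β * K 1 := by
      split_ifs
      · rw [abs_mul, abs_mul, abs_of_pos hβ]
        calc β * |A s| * |gibbs β s j| ≤ β * K 1 * 1 := by
              have := hA s
              have := hp1 s j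
              gcongr
          _ = _ := mul_one _
      · simpa using by positivity
    calc _ ≤ |(E s - β * A s) * (gibbs β s j * gibbs β s k)| +
          |if j = k then β * A s * gibbs β s j else 0| := abs_add_le _ _
      _ ≤ (K 2 + β * K 1) * 1 + β * K 1 := by
          rw [abs_mul]
          gcongr
      _ ≤ _ := by linarith
  · intro s x
    set m := gibbsMoment β s x with hmdef
    set F : ℝ → ℝ := fun t => smoothMax β (s + t • x) with hF
    have dF : ∀ t, HasDerivAt F (m 1 t) t := fun t => hasDerivAt_smoothMax hβ.ne' t
    have dm : ∀ k t, HasDerivAt (m k) (β * (m (k + 1) t - m k t * m 1 t)) t := fun k t =>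
      hasDerivAt_gibbsMoment k t
    have dg : ∀ i t, HasDerivAt (fun t => g i (F t)) (g (i + 1) (F t) * m 1 t) t := fun i t =>
      (hg i (F t)).comp t (dF t)
    -- Derivatives of `F` are powers of `β` times cumulants under the Gibbs weights. As `|m k| ≤
    -- ‖x‖^k`, the second cumulant is at most `2 ‖x‖²` and the third at most `(1 + 3 + 2) ‖x‖³`,
    -- which gives the coefficients `1`, `3 · 2` and `6`.
    have key := abs_taylor_two_le (h := fun t => g 0 (F t)) (h1 := fun t => g 1 (F t) * m 1 t)
      (h2 := fun t => g 2 (F t) * m 1 t * m 1 t + g 1 (F t) * (β * (m 2 t - m 1 t * m 1 t)))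
      (h3 := fun t => g 3 (F t) * m 1 t ^ 3 + 3 * (g 2 (F t) * m 1 t * (β * (m 2 t - m 1 t * m 1 t)))
        + g 1 (F t) * (β ^ 2 * (m 3 t - 3 * m 2 t * m 1 t + 2 * m 1 t ^ 3)))
      (K := (K 3 + 6 * K 2 * β + 6 * K 1 * β ^ 2) * ‖x‖ ^ 3) (dg 0)
      (fun t => (dg 1 t).mul (dm 1 t)) (fun t => ?_) (fun t => ?_)
    · have e0 : F 0 = smoothMax β s := by simp [hF]
      have e1 : F 1 = smoothMax β (s + x) := by simp [hF]
      simp only [e0, e1] at key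
      convert key using 3
      congr 1
      · congr 1
        simp only [hmdef, gibbsMoment_zero, Finset.mul_sum, pow_one, A]
        exact Finset.sum_congr rfl fun j _ => by ring
      · congr 1
        simp only [hmdef, gibbsMoment_zero, pow_one]
        simp only [add_mul, ite_mul, zero_mul, Finset.sum_add_distrib, Finset.sum_ite_eq,
          Finset.mem_univ, if_true]
        have q1 : ∑ j, ∑ k, (E s - β * A s) * (gibbs β s j * gibbs β s k) * (x j * x k) =
            (E s - β * A s) * ((∑ j, gibbs β s j * x j) * ∑ j, gibbs β s j * x j) := by
          rw [Finset.sum_mul_sum, Finset.mul_sum]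
          refine Finset.sum_congr rfl fun j _ => ?_
          rw [Finset.mul_sum]
          exact Finset.sum_congr rfl fun k _ => by ring
        have q2 : ∑ j, β * A s * gibbs β s j * (x j * x j) =
            β * A s * ∑ j, gibbs β s j * x j ^ 2 := by
          rw [Finset.mul_sum]
          exact Finset.sum_congr rfl fun k _ => by ring
        rw [q1, q2]
        simp only [A, E]
        ring
    · have h1 := ((dg 2 t).fun_mul (dm 1 t)).fun_mul (dm 1 t)
      have h2 := (dg 1 t).fun_mul (((dm 2 t).fun_sub ((dm 1 t).fun_mul (dm 1 t))).const_mul β)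
      refine (h1.fun_add h2).congr_deriv ?_
      ring
    · have b1 := abs_gibbsMoment_le (β := β) (s := s) (x := x) 1 t
      have b2 := abs_gibbsMoment_le (β := β) (s := s) (x := x) 2 t
      have b3 := abs_gibbsMoment_le (β := β) (s := s) (x := x) 3 t
      rw [← hmdef] at b1 b2 b3
      rw [pow_one] at b1
      set X := ‖x‖
      have hX : 0 ≤ X := norm_nonneg _
      have c1 : |m 1 t * m 1 t| ≤ X ^ 2 := by
        rw [abs_mul, sq]; gcongr
      have c2 : |m 2 t - m 1 t * m 1 t| ≤ 2 * X ^ 2 := by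
        refine (abs_sub _ _).trans ?_
        linarith
      have c3 : |m 1 t ^ 3| ≤ X ^ 3 := by rw [abs_pow]; gcongr
      have c4 : |3 * m 2 t * m 1 t| ≤ 3 * X ^ 3 := by
        rw [abs_mul, abs_mul]
        calc |(3 : ℝ)| * |m 2 t| * |m 1 t| ≤ 3 * X ^ 2 * X := by
              rw [abs_of_pos (by norm_num : (0 : ℝ) < 3)]; gcongr
          _ = _ := by ring
      have c5 : |m 3 t - 3 * m 2 t * m 1 t + 2 * m 1 t ^ 3| ≤ 6 * X ^ 3 := by
        refine (abs_add_le _ _).trans ?_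
        have := abs_sub (m 3 t) (3 * m 2 t * m 1 t)
        rw [abs_mul, abs_of_pos (by norm_num : (0 : ℝ) < 2)]
        linarith
      have k1 := hK 1 (by norm_num) (F t)
      have k2 := hK 2 (by norm_num) (F t)
      have k3 := hK 3 (by norm_num) (F t)
      have n1 := hK0 1 (by norm_num)
      have n2 := hK0 2 (by norm_num)
      have n3 := hK0 3 (by norm_num)
      refine (abs_add_three _ _ _).trans ?_
      have t1 : |g 3 (F t) * m 1 t ^ 3| ≤ K 3 * X ^ 3 := by
        rw [abs_mul]; gcongr
      have t2 : |3 * (g 2 (F t) * m 1 t * (β * (m 2 t - m 1 t * m 1 t)))| ≤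
          3 * (K 2 * X * (β * (2 * X ^ 2))) := by
        rw [abs_mul, abs_mul, abs_mul, abs_mul β, abs_of_pos hβ,
          abs_of_pos (by norm_num : (0 : ℝ) < 3)]
        gcongr
      have t3 : |g 1 (F t) * (β ^ 2 * (m 3 t - 3 * m 2 t * m 1 t + 2 * m 1 t ^ 3))| ≤
          K 1 * (β ^ 2 * (6 * X ^ 3)) := by
        rw [abs_mul, abs_mul, abs_of_nonneg (sq_nonneg β)]
        gcongr
      calc _ ≤ _ := add_le_add (add_le_add t1 t2) t3
        _ = _ := by ring

end LogSumExp

lemma half_le_log {d : ℕ} (hd : 1 < d) : 1 / 2 ≤ Real.log d := by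
  have h1 : Real.log 2 ≤ Real.log d := Real.log_le_log (by norm_num) (by exact_mod_cast hd)
  linarith [Real.log_two_gt_d9]

/-- A smooth approximation of the indicator of `{M ≤ r}` at scale `δ`. -/
lemma exists_smooth_indicator : ∃ C : ℝ, 0 < C ∧ ∀ (d : ℕ), 1 < d → ∀ (δ : ℝ), 0 < δ → ∀ r : ℝ,
    ∃ f : (Fin d → ℝ) → ℝ, HasTaylor f (C * Real.log d ^ 2 / δ ^ 3) ∧ (∀ x, 0 ≤ f x ∧ f x ≤ 1) ∧
      (∀ x, maxCoord x ≤ r - δ → f x = 1) ∧ ∀ x, r + δ ≤ maxCoord x → f x = 0 := by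
  obtain ⟨g, K, hK0, hg, hK, h01, hone, hzero⟩ := exists_smooth_step
  refine ⟨28 * K, by positivity, fun d hd δ hδ r => ?_⟩
  have : Nonempty (Fin d) := ⟨⟨0, by omega⟩⟩
  have hl := half_le_log hd
  set ℓ := Real.log d with hℓ
  -- With `β = ℓ / δ` the log-sum-exp exceeds the maximum by at most `log d / β = δ`, matching the
  -- width of the step. Since `ℓ ≥ 1/2`, the factor `1 + 6ℓ + 6ℓ²` is below `28 ℓ²`.
  have hβ : 0 < ℓ / δ := by positivity
  set g' : ℕ → ℝ → ℝ := fun i u => g i ((u - r) / δ) / δ ^ i with hg'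
  have hder : ∀ i u, HasDerivAt (g' i) (g' (i + 1) u) u := by
    intro i u
    have h1 : HasDerivAt (fun u : ℝ => (u - r) / δ) (1 / δ) u :=
      ((hasDerivAt_id u).sub_const r).div_const δ
    refine (((hg i ((u - r) / δ)).comp u h1).div_const (δ ^ i)).congr_deriv ?_
    simp only [hg']
    field_simp
    ring
  have hbd : ∀ i ≤ 3, ∀ u, |g' i u| ≤ K / δ ^ i := by
    intro i hi u
    simp only [hg']
    rw [abs_div, abs_of_pos (pow_pos hδ i)]
    have := hK i hi ((u - r) / δ)
    gcongr
  have hT := hasTaylor_comp_smoothMax (d := d) hβ hder (K := fun i => K / δ ^ i) hbd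
  refine ⟨fun s => g' 0 (smoothMax (ℓ / δ) s), ?_, fun x => ?_, fun x hx => ?_, fun x hx => ?_⟩
  · obtain ⟨G, H, B, m1, m2, m3, b1, b2, b3, hrem⟩ := hT
    refine ⟨G, H, B, m1, m2, m3, b1, b2, b3, fun s x => (hrem s x).trans ?_⟩
    gcongr
    have : K / δ ^ 3 + 6 * (K / δ ^ 2) * (ℓ / δ) + 6 * (K / δ ^ 1) * (ℓ / δ) ^ 2 =
        K * (1 + 6 * ℓ + 6 * ℓ ^ 2) / δ ^ 3 := by field_simp
    rw [this]
    have h2 : 1 + 6 * ℓ + 6 * ℓ ^ 2 ≤ 28 * ℓ ^ 2 := by nlinarith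
    have h3 : K * (1 + 6 * ℓ + 6 * ℓ ^ 2) ≤ 28 * K * ℓ ^ 2 := by nlinarith
    gcongr
  · simpa [hg'] using h01 _
  · simp only [hg', pow_zero, div_one]
    refine hone _ (div_nonpos_of_nonpos_of_nonneg ?_ hδ.le)
    have h1 := smoothMax_le (s := x) hβ
    have h2 : Real.log d / (ℓ / δ) = δ := by rw [← hℓ]; field_simp
    linarith
  · simp only [hg', pow_zero, div_one]
    refine hzero _ ?_
    rw [le_div_iff₀ hδ]
    have := maxCoord_le_smoothMax (s := x) hβ
    linarith

end MDSBerryEsseen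

/-! ### Lindeberg's method for increments with deterministic conditional covariances. -/

namespace MDSBerryEsseen

variable {d : ℕ}

lemma integrable_of_bounded {Ω : Type*} {mΩ : MeasurableSpace Ω} {P : Measure Ω}
    [IsProbabilityMeasure P] {f : Ω → ℝ} (hf : Measurable f) {B : ℝ} (hB : ∀ ω, |f ω| ≤ B) :
    Integrable f P :=
  (integrable_const B).mono' hf.aestronglyMeasurable (ae_of_all _ hB)

lemma abs_integral_le_of_bounded {Ω : Type*} {mΩ : MeasurableSpace Ω} {P : Measure Ω}
    [IsProbabilityMeasure P] {f : Ω → ℝ} {B : ℝ} (hB : ∀ ω, |f ω| ≤ B) :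
    |∫ ω, f ω ∂P| ≤ B := by
  have := norm_integral_le_of_norm_le_const (μ := P) (f := f) (C := B) (ae_of_all _ hB)
  simpa using this

lemma measurable_integral_translate {ρ : Measure (Fin d → ℝ)} [IsProbabilityMeasure ρ]
    {f : (Fin d → ℝ) → ℝ} (hf : Measurable f) : Measurable fun s => ∫ y, f (s + y) ∂ρ :=
  (StronglyMeasurable.integral_prod_right (f := fun s y => f (s + y))
    (by apply Measurable.stronglyMeasurable; fun_prop)).measurable

/-- Averaging over translations preserves Taylor expansions. -/
lemma HasTaylor.average {f : (Fin d → ℝ) → ℝ} {K : ℝ} (h : HasTaylor f K)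
    (ρ : Measure (Fin d → ℝ)) [IsProbabilityMeasure ρ] :
    HasTaylor (fun s => ∫ y, f (s + y) ∂ρ) K := by
  obtain ⟨G, H, B, mf, mG, mH, bf, bG, bH, hrem⟩ := h
  refine ⟨fun s j => ∫ y, G (s + y) j ∂ρ, fun s j k => ∫ y, H (s + y) j k ∂ρ, B,
    measurable_integral_translate mf, fun j => measurable_integral_translate (mG j),
    fun j k => measurable_integral_translate (mH j k),
    fun s => abs_integral_le_of_bounded fun y => bf _,
    fun s j => abs_integral_le_of_bounded fun y => bG _ _,
    fun s j k => abs_integral_le_of_bounded fun y => bH _ _ _, fun s x => ?_⟩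
  have i1 : ∀ s, Integrable (fun y => f (s + y)) ρ := fun s =>
    integrable_of_bounded (mf.comp (by fun_prop)) fun y => bf _
  have i2 : ∀ j, Integrable (fun y => G (s + y) j * x j) ρ := fun j =>
    (integrable_of_bounded ((mG j).comp (by fun_prop : Measurable fun y => s + y))
      fun y => bG _ _).mul_const _
  have i3 : ∀ j k, Integrable (fun y => H (s + y) j k * (x j * x k)) ρ := fun j k =>
    (integrable_of_bounded ((mH j k).comp (by fun_prop : Measurable fun y => s + y))
      fun y => bH _ _ _).mul_const _
  have i2' := integrable_finsetSum Finset.univ fun j _ => i2 j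
  have i3' := integrable_finsetSum Finset.univ fun j _ =>
    integrable_finsetSum Finset.univ fun k _ => i3 j k
  have e : (∫ y, f (s + x + y) ∂ρ) - ((∫ y, f (s + y) ∂ρ) + ∑ j, (∫ y, G (s + y) j ∂ρ) * x j +
      1 / 2 * ∑ j, ∑ k, (∫ y, H (s + y) j k ∂ρ) * (x j * x k)) =
      ∫ y, (f (s + x + y) - (f (s + y) + ∑ j, G (s + y) j * x j +
        1 / 2 * ∑ j, ∑ k, H (s + y) j k * (x j * x k))) ∂ρ := by
    have i4 : Integrable (fun y => f (s + y) + ∑ j, G (s + y) j * x j) ρ := (i1 s).add i2'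
    rw [integral_sub (i1 _) (i4.fun_add (i3'.const_mul _)), integral_add i4 (i3'.const_mul _),
      integral_add (i1 s) i2', integral_const_mul, integral_finsetSum _ fun j _ => i2 j,
      integral_finsetSum _ fun j _ => integrable_finsetSum Finset.univ fun k _ => i3 j k]
    have w : ∀ j, ∫ y, ∑ k, H (s + y) j k * (x j * x k) ∂ρ =
        ∑ k, (∫ y, H (s + y) j k ∂ρ) * (x j * x k) := fun j => by
      rw [integral_finsetSum _ fun k _ => i3 j k]
      simp only [integral_mul_const]
    simp only [w, integral_mul_const]
  rw [e]
  refine abs_integral_le_of_bounded fun y => ?_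
  have := hrem (s + y) x
  rwa [add_right_comm] at this

section Moments

variable {Ω : Type*} {mΩ : MeasurableSpace Ω} {P : Measure Ω}

lemma integrable_pow_of_cube [IsProbabilityMeasure P] {X : Ω → Fin d → ℝ}
    (h3 : Integrable (fun ω => ‖X ω‖ ^ 3) P) {f : Ω → ℝ} (hf : Measurable f) {C : ℝ}
    (hle : ∀ ω, |f ω| ≤ C * (1 + ‖X ω‖ ^ 3)) : Integrable f P :=
  (((integrable_const 1).add h3).const_mul C).mono' hf.aestronglyMeasurable (ae_of_all _ hle)

lemma integrable_coord [IsProbabilityMeasure P] {X : Ω → Fin d → ℝ} (hX : Measurable X)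
    (h3 : Integrable (fun ω => ‖X ω‖ ^ 3) P) (j : Fin d) : Integrable (fun ω => X ω j) P := by
  refine integrable_pow_of_cube h3 (by fun_prop) (C := 1) fun ω => ?_
  have h1 : |X ω j| ≤ ‖X ω‖ := norm_le_pi_norm (X ω) j
  have h0 := norm_nonneg (X ω)
  nlinarith [sq_nonneg (‖X ω‖ - 1), mul_nonneg h0 (sq_nonneg (‖X ω‖ - 1))]

lemma memLp_two_coord [IsProbabilityMeasure P] {X : Ω → Fin d → ℝ} (hX : Measurable X)
    (h3 : Integrable (fun ω => ‖X ω‖ ^ 3) P) (j : Fin d) : MemLp (fun ω => X ω j) 2 P := by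
  rw [memLp_two_iff_integrable_sq (by fun_prop)]
  refine integrable_pow_of_cube h3 (by fun_prop) (C := 1) fun ω => ?_
  have h1 : |X ω j| ≤ ‖X ω‖ := norm_le_pi_norm (X ω) j
  have h0 := norm_nonneg (X ω)
  rw [abs_pow]
  have h2 : |X ω j| ^ 2 ≤ ‖X ω‖ ^ 2 := by gcongr
  nlinarith [sq_nonneg (‖X ω‖ - 1), mul_nonneg h0 (sq_nonneg (‖X ω‖ - 1))]

lemma integrable_coord_mul [IsProbabilityMeasure P] {X Y : Ω → Fin d → ℝ} (hX : Measurable X) (hY : Measurable Y)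
    (h3 : Integrable (fun ω => ‖X ω‖ ^ 3) P) (h3' : Integrable (fun ω => ‖Y ω‖ ^ 3) P)
    (j k : Fin d) : Integrable (fun ω => X ω j * Y ω k) P :=
  (memLp_two_coord hX h3 j).integrable_mul (memLp_two_coord hY h3' k)

/-- Replacing an increment with prescribed conditional moments by its Taylor expansion. -/
lemma HasTaylor.abs_integral_sub_le [IsProbabilityMeasure P] {f : (Fin d → ℝ) → ℝ} {K : ℝ}
    {G : (Fin d → ℝ) → Fin d → ℝ} {H : (Fin d → ℝ) → Fin d → Fin d → ℝ} {B : ℝ}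
    (mf : Measurable f) (mG : ∀ j, Measurable fun s => G s j)
    (mH : ∀ j k, Measurable fun s => H s j k) (bf : ∀ s, |f s| ≤ B) (bG : ∀ s j, |G s j| ≤ B)
    (bH : ∀ s j k, |H s j k| ≤ B)
    (hrem : ∀ s x, |f (s + x) - (f s + ∑ j, G s j * x j +
      1 / 2 * ∑ j, ∑ k, H s j k * (x j * x k))| ≤ K * ‖x‖ ^ 3)
    {S X : Ω → Fin d → ℝ} (hS : Measurable S) (hX : Measurable X)
    (h3 : Integrable (fun ω => ‖X ω‖ ^ 3) P) {A : Matrix (Fin d) (Fin d) ℝ}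
    (h1 : ∀ (a : (Fin d → ℝ) → ℝ), Measurable a → (∀ s, |a s| ≤ B) → ∀ j,
      ∫ ω, a (S ω) * X ω j ∂P = 0)
    (h2 : ∀ (a : (Fin d → ℝ) → ℝ), Measurable a → (∀ s, |a s| ≤ B) → ∀ j k,
      ∫ ω, a (S ω) * (X ω j * X ω k) ∂P = A j k * ∫ ω, a (S ω) ∂P) :
    |∫ ω, f (S ω + X ω) ∂P - ((∫ ω, f (S ω) ∂P) + 1 / 2 * ∑ j, ∑ k, A j k * ∫ ω, H (S ω) j k ∂P)|
      ≤ K * ∫ ω, ‖X ω‖ ^ 3 ∂P := by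
  have i0 : Integrable (fun ω => f (S ω + X ω)) P :=
    integrable_of_bounded (mf.comp (hS.add hX)) fun ω => bf _
  have i1 : Integrable (fun ω => f (S ω)) P := integrable_of_bounded (mf.comp hS) fun ω => bf _
  have i2 : ∀ j, Integrable (fun ω => G (S ω) j * X ω j) P := fun j =>
    (integrable_coord hX h3 j).bdd_mul ((mG j).comp hS).aestronglyMeasurable
      (ae_of_all _ fun ω => bG _ _)
  have i3 : ∀ j k, Integrable (fun ω => H (S ω) j k * (X ω j * X ω k)) P := fun j k =>
    (integrable_coord_mul hX hX h3 h3 j k).bdd_mul ((mH j k).comp hS).aestronglyMeasurable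
      (ae_of_all _ fun ω => bH _ _ _)
  have i2' := integrable_finsetSum Finset.univ fun j _ => i2 j
  have i3' := integrable_finsetSum Finset.univ fun j _ =>
    integrable_finsetSum Finset.univ fun k _ => i3 j k
  have i4 : Integrable (fun ω => f (S ω) + ∑ j, G (S ω) j * X ω j) P := i1.add i2'
  have e : ∫ ω, f (S ω + X ω) ∂P - ((∫ ω, f (S ω) ∂P) +
      1 / 2 * ∑ j, ∑ k, A j k * ∫ ω, H (S ω) j k ∂P) =
      ∫ ω, (f (S ω + X ω) - (f (S ω) + ∑ j, G (S ω) j * X ω j +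
        1 / 2 * ∑ j, ∑ k, H (S ω) j k * (X ω j * X ω k))) ∂P := by
    rw [integral_sub i0 (i4.fun_add (i3'.const_mul _)), integral_add i4 (i3'.const_mul _),
      integral_add i1 i2', integral_const_mul, integral_finsetSum _ fun j _ => i2 j,
      integral_finsetSum _ fun j _ => integrable_finsetSum Finset.univ fun k _ => i3 j k]
    have z : ∀ j, ∫ ω, G (S ω) j * X ω j ∂P = 0 := fun j =>
      h1 (fun s => G s j) (mG j) (fun s => bG s j) j
    have w : ∀ j, ∫ ω, ∑ k, H (S ω) j k * (X ω j * X ω k) ∂P =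
        ∑ k, A j k * ∫ ω, H (S ω) j k ∂P := fun j => by
      rw [integral_finsetSum _ fun k _ => i3 j k]
      exact Finset.sum_congr rfl fun k _ => h2 (fun s => H s j k) (mH j k) (fun s => bH s j k) j k
    simp only [z, w, Finset.sum_const_zero, add_zero]
  rw [e, ← integral_const_mul, ← Real.norm_eq_abs]
  exact norm_integral_le_of_norm_le (h3.const_mul K) (ae_of_all _ fun ω => hrem (S ω) (X ω))

/-- One Lindeberg exchange. -/
lemma HasTaylor.abs_exchange_le [IsProbabilityMeasure P] {f : (Fin d → ℝ) → ℝ} {K : ℝ} (h : HasTaylor f K)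
    {S X : Ω → Fin d → ℝ} (hS : Measurable S) (hX : Measurable X)
    (h3 : Integrable (fun ω => ‖X ω‖ ^ 3) P) {A : Matrix (Fin d) (Fin d) ℝ}
    (h1 : ∀ (B : ℝ) (a : (Fin d → ℝ) → ℝ), Measurable a → (∀ s, |a s| ≤ B) → ∀ j,
      ∫ ω, a (S ω) * X ω j ∂P = 0)
    (h2 : ∀ (B : ℝ) (a : (Fin d → ℝ) → ℝ), Measurable a → (∀ s, |a s| ≤ B) → ∀ j k,
      ∫ ω, a (S ω) * (X ω j * X ω k) ∂P = A j k * ∫ ω, a (S ω) ∂P)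
    (ρ : Measure (Fin d → ℝ)) [IsProbabilityMeasure ρ] (g1 : ∀ j, ∫ y, y j ∂ρ = 0)
    (g2 : ∀ j k, ∫ y, y j * y k ∂ρ = A j k) (g3 : Integrable (fun y => ‖y‖ ^ 3) ρ) :
    |∫ ω, f (S ω + X ω) ∂P - ∫ ω, (∫ y, f (S ω + y) ∂ρ) ∂P| ≤
      K * (∫ ω, ‖X ω‖ ^ 3 ∂P + ∫ y, ‖y‖ ^ 3 ∂ρ) := by
  obtain ⟨G, H, B, mf, mG, mH, bf, bG, bH, hrem⟩ := h
  have hP := HasTaylor.abs_integral_sub_le mf mG mH bf bG bH hrem hS hX h3 (h1 B) (h2 B)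
  have hρ : ∀ s, |∫ y, f (s + y) ∂ρ - (f s + 1 / 2 * ∑ j, ∑ k, A j k * H s j k)| ≤
      K * ∫ y, ‖y‖ ^ 3 ∂ρ := fun s => by
    -- The same expansion under the Gaussian law at a frozen base point. Its quadratic term,
    -- integrated over `S`, is the one found under `P`, so only the remainders survive.
    have := HasTaylor.abs_integral_sub_le (P := ρ) (S := fun _ => s) (X := id) (A := A) mf mG mH
      bf bG bH hrem measurable_const measurable_id g3
      (fun a _ _ j => by simp [integral_const_mul, g1])
      (fun a _ _ j k => by simp [integral_const_mul, g2, mul_comm])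
    simpa using this
  have i1 : Integrable (fun ω => f (S ω)) P := integrable_of_bounded (mf.comp hS) fun ω => bf _
  have i3 : ∀ j k, Integrable (fun ω => A j k * H (S ω) j k) P := fun j k =>
    (integrable_of_bounded ((mH j k).comp hS) fun ω => bH _ _ _).const_mul _
  have i3' := integrable_finsetSum Finset.univ fun j _ =>
    integrable_finsetSum Finset.univ fun k _ => i3 j k
  have i0 : Integrable (fun ω => ∫ y, f (S ω + y) ∂ρ) P :=
    integrable_of_bounded ((measurable_integral_translate mf).comp hS) fun ω =>
      abs_integral_le_of_bounded fun y => bf _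
  have e : (∫ ω, (∫ y, f (S ω + y) ∂ρ) ∂P) - ((∫ ω, f (S ω) ∂P) +
      1 / 2 * ∑ j, ∑ k, A j k * ∫ ω, H (S ω) j k ∂P) =
      ∫ ω, ((∫ y, f (S ω + y) ∂ρ) - (f (S ω) + 1 / 2 * ∑ j, ∑ k, A j k * H (S ω) j k)) ∂P := by
    rw [integral_sub i0 (i1.fun_add (i3'.const_mul _)), integral_add i1 (i3'.const_mul _),
      integral_const_mul,
      integral_finsetSum _ fun j _ => integrable_finsetSum Finset.univ fun k _ => i3 j k]
    congr 3
    refine Finset.sum_congr rfl fun j _ => ?_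
    rw [integral_finsetSum _ fun k _ => i3 j k]
    simp only [integral_const_mul]
  have hQ : |(∫ ω, (∫ y, f (S ω + y) ∂ρ) ∂P) - ((∫ ω, f (S ω) ∂P) +
      1 / 2 * ∑ j, ∑ k, A j k * ∫ ω, H (S ω) j k ∂P)| ≤ K * ∫ y, ‖y‖ ^ 3 ∂ρ := by
    rw [e]
    exact abs_integral_le_of_bounded fun ω => hρ _
  rw [abs_le] at *
  constructor <;> linarith

lemma integral_mul_eq_of_condExp_eq_const [IsProbabilityMeasure P] {m : MeasurableSpace Ω} (hm : m ≤ mΩ) {a X : Ω → ℝ}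
    (ha : Measurable[m] a) (hX : Integrable X P) (haX : Integrable (fun ω => a ω * X ω) P) {c : ℝ}
    (h : P[X | m] =ᵐ[P] fun _ => c) : ∫ ω, a ω * X ω ∂P = c * ∫ ω, a ω ∂P := by
  have h1 := condExp_mul_of_stronglyMeasurable_left (μ := P) (m := m) ha.stronglyMeasurable haX hX
  calc ∫ ω, a ω * X ω ∂P = ∫ ω, (P[a * X | m]) ω ∂P := (integral_condExp hm).symm
    _ = ∫ ω, c * a ω ∂P := by
        refine integral_congr_ae ?_
        filter_upwards [h1, h] with ω e1 e2
        rw [e1, Pi.mul_apply, e2, mul_comm]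
    _ = _ := integral_const_mul _ _

/-- The partial sums of a sequence of vectors. -/
def partialSum (X : ℕ → Ω → Fin d → ℝ) (n : ℕ) (ω : Ω) : Fin d → ℝ := ∑ i ∈ Finset.range n, X i ω

lemma measurable_partialSum {X : ℕ → Ω → Fin d → ℝ} (hX : ∀ i, Measurable (X i)) (n : ℕ) :
    Measurable (partialSum X n) := by
  unfold partialSum
  fun_prop

lemma integrable_cube_partialSum {X : ℕ → Ω → Fin d → ℝ} (hX : ∀ i, Measurable (X i)) {n : ℕ}
    (h3 : ∀ i < n, Integrable (fun ω => ‖X i ω‖ ^ 3) P) :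
    Integrable (fun ω => ‖partialSum X n ω‖ ^ 3) P := by
  have key : ∀ Y : Ω → Fin d → ℝ, Measurable Y →
      (Integrable (fun ω => ‖Y ω‖ ^ 3) P ↔ MemLp Y 3 P) := fun Y hY => by
    have := integrable_norm_rpow_iff (μ := P) (f := Y) (p := 3) hY.aestronglyMeasurable
      (by norm_num) (by norm_num)
    rw [← this]
    norm_num
  rw [key _ (measurable_partialSum hX n)]
  exact memLp_finsetSum (Finset.range n) fun i hi =>
    (key _ (hX i)).1 (h3 i (Finset.mem_range.1 hi))

/-- The increments of the partial sums are conditionally centred, with deterministic conditional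
covariance matrices `A i`. -/
structure HasCondMoments (P : Measure Ω) (X : ℕ → Ω → Fin d → ℝ) (n : ℕ)
    (A : ℕ → Matrix (Fin d) (Fin d) ℝ) : Prop where
  measurable : ∀ i, Measurable (X i)
  integrable : ∀ i < n, Integrable (fun ω => ‖X i ω‖ ^ 3) P
  mean : ∀ i < n, ∀ j, P[fun ω => X i ω j | MeasurableSpace.comap (partialSum X i) inferInstance]
    =ᵐ[P] fun _ => 0
  cov : ∀ i < n, ∀ j k,
    P[fun ω => X i ω j * X i ω k | MeasurableSpace.comap (partialSum X i) inferInstance]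
      =ᵐ[P] fun _ => A i j k

lemma HasCondMoments.mono {X : ℕ → Ω → Fin d → ℝ} {n m : ℕ} {A : ℕ → Matrix (Fin d) (Fin d) ℝ}
    (h : HasCondMoments P X n A) (hmn : m ≤ n) : HasCondMoments P X m A :=
  ⟨h.measurable, fun i hi => h.integrable i (hi.trans_le hmn),
    fun i hi => h.mean i (hi.trans_le hmn), fun i hi => h.cov i (hi.trans_le hmn)⟩

/-- The exchange tests increments only against functions of the preceding partial sum, which is why
`HasCondMoments` conditions on that sum and not on the whole past. -/
lemma HasCondMoments.integral_mul_mul [IsProbabilityMeasure P] {X : ℕ → Ω → Fin d → ℝ} {n : ℕ}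
    {A : ℕ → Matrix (Fin d) (Fin d) ℝ} (h : HasCondMoments P X n A) {i : ℕ} (hi : i < n)
    {B : ℝ} {a : (Fin d → ℝ) → ℝ} (ha : Measurable a) (hB : ∀ s, |a s| ≤ B) (j k : Fin d) :
    ∫ ω, a (partialSum X i ω) * (X i ω j * X i ω k) ∂P =
      A i j k * ∫ ω, a (partialSum X i ω) ∂P := by
  have hm := measurable_partialSum h.measurable i
  have i2 := integrable_coord_mul (h.measurable i) (h.measurable i) (h.integrable i hi)
    (h.integrable i hi) j k
  exact integral_mul_eq_of_condExp_eq_const hm.comap_le (ha.comp (comap_measurable _)) i2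
    (i2.bdd_mul (ha.comp hm).aestronglyMeasurable (ae_of_all _ fun ω => hB _)) (h.cov i hi j k)

/-- Integrability is assumed instead of boundedness of `a`, because `a` is also taken to be a
coordinate when the cross terms in the covariance of the sum are removed. -/
lemma HasCondMoments.integral_mul [IsProbabilityMeasure P] {X : ℕ → Ω → Fin d → ℝ} {n : ℕ}
    {A : ℕ → Matrix (Fin d) (Fin d) ℝ} (h : HasCondMoments P X n A) {i : ℕ} (hi : i < n)
    {a : (Fin d → ℝ) → ℝ} (ha : Measurable a) (j : Fin d)
    (hint : Integrable (fun ω => a (partialSum X i ω) * X i ω j) P) :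
    ∫ ω, a (partialSum X i ω) * X i ω j ∂P = 0 := by
  have hm := measurable_partialSum h.measurable i
  have := integral_mul_eq_of_condExp_eq_const hm.comap_le (ha.comp (comap_measurable _))
    (integrable_coord (h.measurable i) (h.integrable i hi) j) hint (h.mean i hi j)
  rwa [zero_mul] at this

lemma HasCondMoments.cov_eq [IsProbabilityMeasure P] {X : ℕ → Ω → Fin d → ℝ} {n : ℕ}
    {A : ℕ → Matrix (Fin d) (Fin d) ℝ} (h : HasCondMoments P X n A) {i : ℕ} (hi : i < n)
    (j k : Fin d) : ∫ ω, X i ω j * X i ω k ∂P = A i j k := by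
  simpa using h.integral_mul_mul hi (a := fun _ => 1) (B := 1) measurable_const (by simp) j k

lemma posSemidef_of_integral_eq {X : Ω → Fin d → ℝ} {A : Matrix (Fin d) (Fin d) ℝ}
    (hint : ∀ j k, Integrable (fun ω => X ω j * X ω k) P)
    (h : ∀ j k, ∫ ω, X ω j * X ω k ∂P = A j k) : A.PosSemidef := by
  refine Matrix.PosSemidef.of_dotProduct_mulVec_nonneg ?_ fun t => ?_
  · ext j k
    simp only [Matrix.conjTranspose_apply, star_trivial, ← h, mul_comm]
  · have : star t ⬝ᵥ A.mulVec t = ∫ ω, (∑ j, t j * X ω j) ^ 2 ∂P := by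
      have e : ∀ ω, (∑ j, t j * X ω j) ^ 2 = ∑ j, ∑ k, (t j * t k) * (X ω j * X ω k) := by
        intro ω
        rw [sq, Finset.sum_mul_sum]
        exact Finset.sum_congr rfl fun j _ => Finset.sum_congr rfl fun k _ => by ring
      simp only [e]
      rw [integral_finsetSum _ fun j _ => integrable_finsetSum _ fun k _ => (hint j k).const_mul _]
      simp only [dotProduct, Matrix.mulVec, Finset.mul_sum, star_trivial]
      refine Finset.sum_congr rfl fun j _ => ?_
      rw [integral_finsetSum _ fun k _ => (hint j k).const_mul _]
      refine Finset.sum_congr rfl fun k _ => ?_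
      rw [integral_const_mul, h]
      ring
    rw [this]
    exact integral_nonneg fun ω => sq_nonneg _

lemma HasCondMoments.posSemidef [IsProbabilityMeasure P] {X : ℕ → Ω → Fin d → ℝ} {n : ℕ}
    {A : ℕ → Matrix (Fin d) (Fin d) ℝ} (h : HasCondMoments P X n A) {i : ℕ} (hi : i < n) :
    (A i).PosSemidef :=
  posSemidef_of_integral_eq (fun j k => integrable_coord_mul (h.measurable i) (h.measurable i)
    (h.integrable i hi) (h.integrable i hi) j k) (h.cov_eq hi)

/-- The second moment matrix of the sum is the sum of the covariance matrices. -/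
lemma HasCondMoments.integral_partialSum_mul [IsProbabilityMeasure P] {X : ℕ → Ω → Fin d → ℝ} {n : ℕ}
    {A : ℕ → Matrix (Fin d) (Fin d) ℝ} (h : HasCondMoments P X n A) (j k : Fin d) :
    ∫ ω, partialSum X n ω j * partialSum X n ω k ∂P = (∑ i ∈ Finset.range n, A i) j k := by
  induction n with
  | zero => simp [partialSum]
  | succ n ih =>
    have hS := measurable_partialSum h.measurable n
    have hX := h.measurable n
    have h3 := integrable_cube_partialSum h.measurable (h.mono n.le_succ).integrable
    have h3' := h.integrable n n.lt_succ_self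
    have e : ∀ ω, partialSum X (n + 1) ω j * partialSum X (n + 1) ω k =
        partialSum X n ω j * partialSum X n ω k + partialSum X n ω j * X n ω k +
          (partialSum X n ω k * X n ω j + X n ω j * X n ω k) := by
      intro ω
      simp only [partialSum, Finset.sum_range_succ, Pi.add_apply]
      ring
    simp only [e]
    have j1 := integrable_coord_mul hS hS h3 h3 j k
    have j2 := integrable_coord_mul hS hX h3 h3' j k
    have j3 := integrable_coord_mul hS hX h3 h3' k j
    have j4 := integrable_coord_mul hX hX h3' h3' j k
    have z1 := h.integral_mul n.lt_succ_self (a := fun s => s j) (by fun_prop) k j2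
    have z2 := h.integral_mul n.lt_succ_self (a := fun s => s k) (by fun_prop) j j3
    rw [integral_add (j1.fun_add j2) (j3.fun_add j4), integral_add j1 j2, integral_add j3 j4,
      ih (h.mono n.le_succ), z1, z2, h.cov_eq n.lt_succ_self, Finset.sum_range_succ,
      Matrix.add_apply]
    ring

/-- Lindeberg's method. -/
theorem HasCondMoments.abs_integral_sub_le [IsProbabilityMeasure P] (hd : 1 < d) {X : ℕ → Ω → Fin d → ℝ} {n : ℕ}
    {A : ℕ → Matrix (Fin d) (Fin d) ℝ} (h : HasCondMoments P X n A) {f : (Fin d → ℝ) → ℝ} {K : ℝ}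
    (hK : 0 ≤ K) (hf : HasTaylor f K) (ρ : Measure (Fin d → ℝ)) [IsProbabilityMeasure ρ]
    (hρ : HasGaussianCharFun ρ (∑ i ∈ Finset.range n, A i)) :
    |∫ ω, f (partialSum X n ω) ∂P - ∫ y, f y ∂ρ| ≤
      K * ((4 + 12 * Real.exp (3 / 2)) * ∑ i ∈ Finset.range n,
        (∫ ω, ‖X i ω‖ ^ 3 ∂P + ((⨆ j, A i j j) * lnp d) ^ (3 / 2 : ℝ))) := by
  induction n generalizing f ρ with
  | zero =>
    have hdirac : HasGaussianCharFun (Measure.dirac (0 : Fin d → ℝ)) 0 := fun t => by simp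
    have : ρ = Measure.dirac 0 := by
      simp only [Finset.range_zero, Finset.sum_empty] at hρ
      exact hρ.ext hdirac
    subst this
    simp [partialSum]
  | succ n ih =>
    have hpsd : (∑ i ∈ Finset.range n, A i).PosSemidef :=
      Matrix.posSemidef_sum _ fun i hi => h.posSemidef ((Finset.mem_range.1 hi).trans n.lt_succ_self)
    have hA := h.posSemidef n.lt_succ_self
    obtain ⟨ρ₁, hρ₁, c₁⟩ := exists_hasGaussianCharFun hpsd
    obtain ⟨ρ₂, hρ₂, c₂⟩ := exists_hasGaussianCharFun hA
    have hconv : ρ = ρ₁.conv ρ₂ := by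
      rw [Finset.sum_range_succ] at hρ
      exact hρ.ext (c₁.conv c₂)
    obtain ⟨g3, g3'⟩ := c₂.third_moment hA hd
    -- The last increment is exchanged first. Its independent Gaussian replacement is absorbed into
    -- the test function by averaging, which keeps the same `K`, so the induction continues with the
    -- averaged function.
    have ih' := ih (h.mono n.le_succ) (hf.average ρ₂) ρ₁ c₁
    have hS := measurable_partialSum h.measurable n
    have hex := hf.abs_exchange_le hS (h.measurable n) (h.integrable n n.lt_succ_self) (A := A n)
      (fun B a ha hB j => h.integral_mul n.lt_succ_self ha j
        ((integrable_coord (h.measurable n) (h.integrable n n.lt_succ_self) j).bdd_mul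
          (ha.comp hS).aestronglyMeasurable (ae_of_all _ fun ω => hB _)))
      (fun B a ha hB j k => h.integral_mul_mul n.lt_succ_self ha hB j k)
      ρ₂ (c₂.integral_eval hA) (c₂.integral_eval_mul_eval hA) g3
    have hint : ∫ y, f y ∂ρ = ∫ s, (∫ y, f (s + y) ∂ρ₂) ∂ρ₁ := by
      obtain ⟨G, H, B, mf, mG, mH, bf, bG, bH, hrem⟩ := hf
      rw [hconv]
      exact integral_conv (integrable_of_bounded mf bf)
    have hsucc : ∀ ω, partialSum X (n + 1) ω = partialSum X n ω + X n ω := fun ω => by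
      simp [partialSum, Finset.sum_range_succ]
    simp only [hsucc]
    rw [hint, Finset.sum_range_succ]
    have hc : (1 : ℝ) ≤ 4 + 12 * Real.exp (3 / 2) := by
      have := Real.exp_pos (3 / 2 : ℝ)
      linarith
    have hX0 : 0 ≤ ∫ ω, ‖X n ω‖ ^ 3 ∂P := integral_nonneg fun ω => by positivity
    have hb : K * (∫ ω, ‖X n ω‖ ^ 3 ∂P + ∫ y, ‖y‖ ^ 3 ∂ρ₂) ≤
        K * ((4 + 12 * Real.exp (3 / 2)) *
          (∫ ω, ‖X n ω‖ ^ 3 ∂P + ((⨆ j, A n j j) * lnp d) ^ (3 / 2 : ℝ))) := by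
      refine mul_le_mul_of_nonneg_left ?_ hK
      rw [mul_add]
      refine add_le_add ?_ g3'
      exact le_mul_of_one_le_left hX0 hc
    rw [abs_le] at *
    constructor <;> linarith

end Moments

end MDSBerryEsseen

/-! ### From smooth test functions to the Kolmogorov distance. -/

namespace MDSBerryEsseen

variable {d : ℕ}

lemma measurable_maxCoord : Measurable (maxCoord : (Fin d → ℝ) → ℝ) := by
  unfold maxCoord
  exact Measurable.iSup fun j => measurable_pi_apply j

lemma measureReal_le_integral {E : Type*} {mE : MeasurableSpace E} {P : Measure E}
    [IsProbabilityMeasure P] {f : E → ℝ} (hf : Integrable f P) (h0 : ∀ x, 0 ≤ f x) {s : Set E}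
    (hs : MeasurableSet s) (h1 : ∀ x ∈ s, f x = 1) : P.real s ≤ ∫ x, f x ∂P := by
  rw [← integral_indicator_one hs]
  refine integral_mono ((integrable_const (1 : ℝ)).indicator hs) hf fun x => ?_
  by_cases hx : x ∈ s
  · simp [hx, h1 x hx]
  · simpa [hx] using h0 x

lemma integral_le_measureReal {E : Type*} {mE : MeasurableSpace E} {P : Measure E}
    [IsProbabilityMeasure P] {f : E → ℝ} (hf : Integrable f P) (h1 : ∀ x, f x ≤ 1) {s : Set E}
    (hs : MeasurableSet s) (h0 : ∀ x ∉ s, f x = 0) : ∫ x, f x ∂P ≤ P.real s := by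
  rw [← integral_indicator_one hs]
  refine integral_mono hf ((integrable_const (1 : ℝ)).indicator hs) fun x => ?_
  by_cases hx : x ∈ s
  · simpa [hx] using h1 x
  · simp [hx, h0 x hx]

/-- Comparison of distribution functions of maxima from comparison of smooth functionals. -/
lemma abs_measureReal_sub_le {P ρ : Measure (Fin d → ℝ)} [IsProbabilityMeasure P]
    [IsProbabilityMeasure ρ] {δ ε η K : ℝ}
    (hsm : ∀ r : ℝ, ∃ f : (Fin d → ℝ) → ℝ, HasTaylor f K ∧ (∀ x, 0 ≤ f x ∧ f x ≤ 1) ∧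
      (∀ x, maxCoord x ≤ r - δ → f x = 1) ∧ ∀ x, r + δ ≤ maxCoord x → f x = 0)
    (hlin : ∀ f : (Fin d → ℝ) → ℝ, HasTaylor f K → |∫ x, f x ∂P - ∫ x, f x ∂ρ| ≤ ε)
    (hac : ∀ r : ℝ, ρ.real {x | r < maxCoord x ∧ maxCoord x ≤ r + 2 * δ} ≤ η) (r : ℝ) :
    |P.real {x | maxCoord x ≤ r} - ρ.real {x | maxCoord x ≤ r}| ≤ ε + η := by
  have hms : ∀ r : ℝ, MeasurableSet {x : Fin d → ℝ | maxCoord x ≤ r} := fun r =>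
    measurableSet_le measurable_maxCoord measurable_const
  have hint : ∀ {Q : Measure (Fin d → ℝ)} [IsProbabilityMeasure Q] {f : (Fin d → ℝ) → ℝ},
      HasTaylor f K → Integrable f Q := by
    rintro Q _ f ⟨G, H, B, mf, mG, mH, bf, -⟩
    exact integrable_of_bounded mf bf
  have hsplit : ∀ r : ℝ, ρ.real {x : Fin d → ℝ | maxCoord x ≤ r + 2 * δ} ≤
      ρ.real {x : Fin d → ℝ | maxCoord x ≤ r} + η := by
    intro r
    refine le_trans (measureReal_mono (fun x hx => ?_)) ((measureReal_union_le
      {x : Fin d → ℝ | maxCoord x ≤ r} {x | r < maxCoord x ∧ maxCoord x ≤ r + 2 * δ}).trans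
      (add_le_add le_rfl (hac r)))
    rcases le_or_gt (maxCoord x) r with h | h
    · exact Or.inl h
    · exact Or.inr ⟨h, hx⟩
  -- The shift by `±δ` sandwiches the indicator: `f` is `1` on `{M ≤ r}` and vanishes once `M ≥ r +
  -- 2δ`, while `g` is `1` on `{M ≤ r - 2δ}` and vanishes once `M ≥ r`.
  obtain ⟨f, hf, f01, f1, f0⟩ := hsm (r + δ)
  obtain ⟨g, hg, g01, g1, g0⟩ := hsm (r - δ)
  have a1 := measureReal_le_integral (P := P) (hint hf) (fun x => (f01 x).1) (hms r)
    (fun x hx => f1 x (by rw [add_sub_cancel_right]; exact hx))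
  have a2 := integral_le_measureReal (P := ρ) (hint hf) (fun x => (f01 x).2) (hms (r + 2 * δ))
    (fun x hx => f0 x (by
      have : r + 2 * δ < maxCoord x := not_le.1 hx
      linarith))
  have b1 := measureReal_le_integral (P := ρ) (hint hg) (fun x => (g01 x).1) (hms (r - 2 * δ))
    (fun x hx => g1 x (by
      have : maxCoord x ≤ r - 2 * δ := hx
      linarith))
  have b2 := integral_le_measureReal (P := P) (hint hg) (fun x => (g01 x).2) (hms r)
    (fun x hx => g0 x (by
      have : r < maxCoord x := not_le.1 hx
      linarith))
  have c1 := hsplit r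
  have c2 := hsplit (r - 2 * δ)
  rw [sub_add_cancel] at c2
  have l1 := abs_le.1 (hlin f hf)
  have l2 := abs_le.1 (hlin g hg)
  rw [abs_le]
  constructor <;> linarith

/-- Gaussian approximation of the maximum of a sum with deterministic conditional covariances. -/
theorem exists_kolmogorov_bound : ∃ C : ℝ, 0 < C ∧
    ∀ {Ω : Type*} {mΩ : MeasurableSpace Ω} {P : Measure Ω} [IsProbabilityMeasure P] {d : ℕ}
      (_ : 1 < d) {X : ℕ → Ω → Fin d → ℝ} {n : ℕ} {A : ℕ → Matrix (Fin d) (Fin d) ℝ}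
      (_ : HasCondMoments P X n A) (ρ : Measure (Fin d → ℝ)) [IsProbabilityMeasure ρ]
      (_ : HasGaussianCharFun ρ (∑ i ∈ Finset.range n, A i)) {v : ℝ} (_ : 0 < v)
      (_ : ∀ k, v ^ 2 ≤ (∑ i ∈ Finset.range n, A i) k k) (r : ℝ),
      |P.real {ω | maxCoord (partialSum X n ω) ≤ r} - ρ.real {x | maxCoord x ≤ r}| ≤
        C * Real.log d ^ (7 / 8 : ℝ) * ((∑ i ∈ Finset.range n,
          (∫ ω, ‖X i ω‖ ^ 3 ∂P + ((⨆ j, A i j j) * lnp d) ^ (3 / 2 : ℝ))) / v ^ 3) ^ (1 / 4 : ℝ) := by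
  obtain ⟨C₀, hC₀, hsm⟩ := exists_smooth_indicator
  set c₁ : ℝ := 4 + 12 * Real.exp (3 / 2)
  have he := Real.exp_pos (3 / 2 : ℝ)
  refine ⟨C₀ * c₁ + 2 * (2 * (1 + 2 * Real.exp (3 / 2))), by positivity, ?_⟩
  intro Ω mΩ P _ d hd X n A hX ρ _ hρ v hv hvA r
  have : Nonempty (Fin d) := ⟨⟨0, by omega⟩⟩
  have hpsdi : ∀ i ∈ Finset.range n, (A i).PosSemidef := fun i hi =>
    hX.posSemidef (Finset.mem_range.1 hi)
  have hpsd : (∑ i ∈ Finset.range n, A i).PosSemidef := Matrix.posSemidef_sum _ hpsdi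
  set Γ := ∑ i ∈ Finset.range n,
    (∫ ω, ‖X i ω‖ ^ 3 ∂P + ((⨆ j, A i j j) * lnp d) ^ (3 / 2 : ℝ)) with hΓ
  have hlnp : 0 < lnp d := lt_of_lt_of_le one_pos (le_max_left _ _)
  have hsup : ∀ i j, A i j j ≤ ⨆ j, A i j j := fun i j =>
    le_ciSup (f := fun j => A i j j) (Set.finite_range _).bddAbove j
  have hterm : ∀ i ∈ Finset.range n,
      0 ≤ ∫ ω, ‖X i ω‖ ^ 3 ∂P + ((⨆ j, A i j j) * lnp d) ^ (3 / 2 : ℝ) := fun i hi => by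
    have h1 : 0 ≤ ∫ ω, ‖X i ω‖ ^ 3 ∂P := integral_nonneg fun ω => by positivity
    have h2 : 0 ≤ ⨆ j, A i j j :=
      (PosSemidef.diag_nonneg' (hpsdi i hi) (Classical.arbitrary _)).trans (hsup i _)
    positivity
  -- The scale `δ` below is proportional to `Γ^{1/4}` and must be positive. The lower bound on the
  -- variances makes some `A i k k` positive.
  have hΓpos : 0 < Γ := by
    set k : Fin d := Classical.arbitrary _
    have h1 : 0 < ∑ i ∈ Finset.range n, A i k k := by
      have := hvA k
      rw [Matrix.sum_apply] at this
      exact lt_of_lt_of_le (by positivity) this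
    obtain ⟨i, hi, hik⟩ := Finset.exists_lt_of_sum_lt (s := Finset.range n) (f := fun _ => (0 : ℝ))
      (g := fun i => A i k k) (by simpa using h1)
    refine Finset.sum_pos' hterm ⟨i, hi, ?_⟩
    have h2 : 0 ≤ ∫ ω, ‖X i ω‖ ^ 3 ∂P := integral_nonneg fun ω => by positivity
    have h3 : 0 < ⨆ j, A i j j := lt_of_lt_of_le hik (hsup i k)
    positivity
  set q := (Γ / v ^ 3) ^ (1 / 4 : ℝ) with hq
  have hqpos : 0 < q := by positivity
  have hq4 : q ^ 4 = Γ / v ^ 3 := by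
    rw [hq, ← Real.rpow_natCast, ← Real.rpow_mul (by positivity)]
    norm_num
  have hl := half_le_log hd
  have hlpos : 0 < Real.log d := by linarith
  set a := Real.log d ^ (1 / 8 : ℝ) with ha
  have hapos : 0 < a := by positivity
  have ha8 : a ^ 8 = Real.log d := by
    rw [ha, ← Real.rpow_natCast, ← Real.rpow_mul hlpos.le]
    norm_num
  have ha7 : Real.log d ^ (7 / 8 : ℝ) = a ^ 7 := by
    rw [ha, ← Real.rpow_natCast, ← Real.rpow_mul hlpos.le]
    norm_num
  have ha4 : a ^ 4 = √(Real.log d) := by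
    rw [← ha8, show a ^ 8 = (a ^ 4) ^ 2 by ring, Real.sqrt_sq (by positivity)]
  -- With `a = (log d)^{1/8}` this balances the errors: `(log d)² Γ / δ³` equals `a^16 q^4 / (a^9
  -- q^3) = a^7 q`, and `(δ / v) √(log d)` equals `a^3 q a^4 = a^7 q`.
  set δ := v * a ^ 3 * q with hδdef
  have hδ : 0 < δ := by positivity
  have hmS := measurable_partialSum hX.measurable n
  have hPS : IsProbabilityMeasure (P.map (partialSum X n)) :=
    Measure.isProbabilityMeasure_map hmS.aemeasurable
  have main := abs_measureReal_sub_le (P := P.map (partialSum X n)) (ρ := ρ) (δ := δ)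
    (K := C₀ * Real.log d ^ 2 / δ ^ 3) (ε := C₀ * c₁ * (a ^ 7 * q))
    (η := 2 * (2 * (1 + 2 * Real.exp (3 / 2))) * (a ^ 7 * q)) (hsm d hd δ hδ) ?_ ?_ r
  · rw [measureReal_def, Measure.map_apply hmS
      (measurableSet_le measurable_maxCoord measurable_const), ← measureReal_def] at main
    refine main.trans (le_of_eq ?_)
    rw [ha7]
    ring
  · intro f hf
    have hL := hX.abs_integral_sub_le hd (by positivity) hf ρ hρ
    have hfm : Measurable f := by
      obtain ⟨G, H, B, mf, -⟩ := hf
      exact mf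
    rw [integral_map hmS.aemeasurable hfm.aestronglyMeasurable]
    refine hL.trans (le_of_eq ?_)
    have hΓq : Γ = q ^ 4 * v ^ 3 := by rw [hq4]; field_simp
    rw [← hΓ, hΓq, ← ha8, hδdef]
    field_simp
    rfl
  · intro r
    refine (hρ.anticoncentration hpsd hd hv hvA r (by positivity : 0 ≤ 2 * δ)).trans ?_
    have hs1 : 1 ≤ √(2 * Real.log d) := by
      rw [Real.one_le_sqrt]
      linarith
    have hs2 : √(2 * Real.log d) ≤ 2 * a ^ 4 := by
      rw [ha4, Real.sqrt_mul (by norm_num)]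
      have : √2 ≤ 2 := by
        rw [Real.sqrt_le_left (by norm_num)]
        norm_num
      gcongr
    have h1 : 1 + Real.exp (3 / 2) * (1 + √(2 * Real.log d)) ≤
        (2 * (1 + 2 * Real.exp (3 / 2))) * a ^ 4 := by nlinarith
    calc 2 * δ / v * (1 + Real.exp (3 / 2) * (1 + √(2 * Real.log d)))
        ≤ 2 * δ / v * ((2 * (1 + 2 * Real.exp (3 / 2))) * a ^ 4) := by gcongr
      _ = _ := by
        rw [hδdef]
        field_simp

end MDSBerryEsseen

/-! ### Regular conditional laws given a σ-field. -/

namespace MDSBerryEsseen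

/-- The regular conditional distribution of `Y` given the σ-field `m`. -/
noncomputable def condLaw {Ω E : Type*} (m : MeasurableSpace Ω) {mΩ : MeasurableSpace Ω}
    {mE : MeasurableSpace E} [StandardBorelSpace E] [Nonempty E] (μ : Measure Ω) [IsFiniteMeasure μ]
    (Y : Ω → E) : @Kernel Ω E m mE :=
  -- Conditioning on the identity, viewed as a map into `(Ω, m)`, is conditioning on `m`.
  @condDistrib Ω Ω E mE _ _ mΩ m Y id μ _

section CondLaw

variable {Ω E : Type*} {m mΩ : MeasurableSpace Ω} {mE : MeasurableSpace E} [StandardBorelSpace E]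
  [Nonempty E] {μ : Measure Ω} [IsProbabilityMeasure μ] {Y : Ω → E}

instance (ω : Ω) : IsProbabilityMeasure (condLaw m μ Y ω) := by
  unfold condLaw
  infer_instance

lemma measurable_lintegral_condLaw {f : E → ENNReal} (hf : Measurable f) :
    Measurable[m] fun ω => ∫⁻ y, f y ∂(condLaw m μ Y ω) :=
  hf.lintegral_kernel

lemma setLIntegral_lintegral_condLaw (hm : m ≤ mΩ) (hY : Measurable Y) {f : E → ENNReal}
    (hf : Measurable f) {g : Ω → ENNReal} (hg : Measurable[m] g) {B : Set Ω}
    (hB : MeasurableSet[m] B) :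
    ∫⁻ ω in B, g ω * ∫⁻ y, f y ∂(condLaw m μ Y ω) ∂μ = ∫⁻ ω in B, g ω * f (Y ω) ∂μ := by
  set g' : Ω → ENNReal := B.indicator g with hg'
  have hg'm : Measurable[m] g' := hg.indicator hB
  have hid : @Measurable Ω Ω mΩ m id := measurable_id'' hm
  have h1 := @compProd_map_condDistrib Ω Ω E mE _ _ mΩ μ _ id Y m hY.aemeasurable
  have hh : @Measurable (Ω × E) ENNReal (m.prod mE) _ fun p => g' p.1 * f p.2 :=
    Measurable.mul (hg'm.comp measurable_fst) (hf.comp measurable_snd)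
  have hpair : @Measurable Ω (Ω × E) mΩ (m.prod mE) fun ω => (id ω, Y ω) :=
    hid.prodMk hY
  have h2 : ∫⁻ p, g' p.1 * f p.2 ∂(@Measure.map Ω (Ω × E) mΩ (m.prod mE) (fun ω => (id ω, Y ω)) μ) =
      ∫⁻ ω, g' ω * f (Y ω) ∂μ := @lintegral_map Ω (Ω × E) mΩ (m.prod mE) μ _ _ hh hpair
  have h3 : @Measurable Ω ENNReal m _
      fun a => ∫⁻ b, g' a * f b ∂(@condDistrib Ω Ω E mE _ _ mΩ m Y id μ _ a) := by
    simp only [lintegral_const_mul _ hf]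
    exact hg'm.mul (measurable_lintegral_condLaw hf)
  rw [← h1, Measure.lintegral_compProd hh, @lintegral_map Ω Ω mΩ m μ _ _ h3 hid] at h2
  have e : ∀ (u : Ω → ENNReal) (ω : Ω), g' ω * u ω = B.indicator (fun ω => g ω * u ω) ω := by
    intro u ω
    by_cases hω : ω ∈ B <;> simp [hg', hω]
  rw [← lintegral_indicator (hm _ hB), ← lintegral_indicator (hm _ hB)]
  simp only [← e]
  rw [← h2]
  refine lintegral_congr fun ω => ?_
  rw [lintegral_const_mul _ hf]
  rfl

lemma ae_eq_of_setLIntegral_eq (hm : m ≤ mΩ) {u w : Ω → ENNReal} (hu : Measurable[m] u)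
    (hw : Measurable[m] w)
    (h : ∀ B, MeasurableSet[m] B → ∫⁻ ω in B, u ω ∂μ = ∫⁻ ω in B, w ω ∂μ) : u =ᵐ[μ] w := by
  have := ae_eq_condLExp hm μ w hu h
  rwa [condLExp_eq_self hm μ hw] at this

lemma condLExp_comp_ae_eq (hm : m ≤ mΩ) (hY : Measurable Y) {f : E → ENNReal} (hf : Measurable f) :
    condLExp m μ (fun ω => f (Y ω)) =ᵐ[μ] fun ω => ∫⁻ y, f y ∂(condLaw m μ Y ω) := by
  refine (ae_eq_condLExp hm μ _ (measurable_lintegral_condLaw hf) fun B hB => ?_).symm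
  simpa using setLIntegral_lintegral_condLaw hm hY hf (g := fun _ => 1) measurable_const hB

lemma condExpect_comp_ae_eq (hm : m ≤ mΩ) (hY : Measurable Y) {f : E → ℝ} (hf : Measurable f)
    (hint : ∀ᵐ ω ∂μ, Integrable f (condLaw m μ Y ω)) :
    condExpect m μ (fun ω => f (Y ω)) =ᵐ[μ] fun ω => ∫ y, f y ∂(condLaw m μ Y ω) := by
  filter_upwards [hint, condLExp_comp_ae_eq (m := m) (μ := μ) hm hY hf.ennreal_ofReal,
    condLExp_comp_ae_eq (m := m) (μ := μ) hm hY hf.neg.ennreal_ofReal] with ω h1 h2 h3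
  rw [condExpect, integral_eq_lintegral_pos_part_sub_lintegral_neg_part h1, h2]
  congr 2

lemma condExp_comp_ae_eq (hm : m ≤ mΩ) (hY : Measurable Y) {F : Type*} [NormedAddCommGroup F]
    [NormedSpace ℝ F] [CompleteSpace F] {f : E → F} (hf : StronglyMeasurable f)
    (hint : Integrable (fun ω => f (Y ω)) μ) :
    μ[fun ω => f (Y ω) | m] =ᵐ[μ] fun ω => ∫ y, f y ∂(condLaw m μ Y ω) := by
  have hid : @Measurable Ω Ω mΩ m id := measurable_id'' hm
  have := condExp_ae_eq_integral_condDistrib (mβ := m) (X := id) hid hY.aemeasurable hf hint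
  rw [MeasurableSpace.comap_id] at this
  exact this

/-- Conditional expectations given a finer σ-field are finite when those given the coarser one
are. -/
lemma condLExp_lt_top_of_le {m' : MeasurableSpace Ω} (hm : m ≤ m') (hm' : m' ≤ mΩ)
    (hY : Measurable[mΩ] Y) {u v : E → ENNReal} (hv : Measurable v) (huv : u ≤ v)
    (hfin : ∀ᵐ ω ∂μ, ∫⁻ y, v y ∂(condLaw m μ Y ω) < ⊤) :
    ∀ᵐ ω ∂μ, condLExp m' μ (fun ω => u (Y ω)) ω < ⊤ := by
  have hmeas := measurable_lintegral_condLaw (m := m) (μ := μ) (Y := Y) hv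
  -- Localisation replaces integrability: `v(Y)` has a finite integral over each `B N`, and these
  -- sets exhaust `Ω` up to a null set.
  set B : ℕ → Set Ω := fun N => {ω | ∫⁻ y, v y ∂(condLaw m μ Y ω) ≤ N} with hBdef
  have hB : ∀ N, MeasurableSet[m] (B N) := fun N => measurableSet_le hmeas measurable_const
  have key : ∀ N, ∀ᵐ ω ∂μ, ω ∈ B N → condLExp m' μ (fun ω => u (Y ω)) ω < ⊤ := by
    intro N
    rw [← ae_restrict_iff' ((hm.trans hm') _ (hB N))]
    refine ae_lt_top (measurable_condLExp' _ _ _) (ne_of_lt ?_)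
    rw [setLIntegral_condLExp hm' μ _ (hm _ (hB N))]
    calc ∫⁻ ω in B N, u (Y ω) ∂μ ≤ ∫⁻ ω in B N, v (Y ω) ∂μ :=
          lintegral_mono fun ω => huv (Y ω)
      _ = ∫⁻ ω in B N, ∫⁻ y, v y ∂(condLaw m μ Y ω) ∂μ := by
          simpa using (setLIntegral_lintegral_condLaw (hm.trans hm') hY hv (g := fun _ => 1)
            measurable_const (hB N)).symm
      _ ≤ ∫⁻ ω in B N, N ∂μ := by
          refine setLIntegral_mono' ((hm.trans hm') _ (hB N)) fun ω hω => hω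
      _ < ⊤ := by
          rw [setLIntegral_const]
          exact ENNReal.mul_lt_top (by simp) (measure_lt_top _ _)
  filter_upwards [hfin, ae_all_iff.2 key] with ω h1 h2
  obtain ⟨N, hN⟩ := ENNReal.exists_nat_gt h1.ne
  exact h2 N hN.le

end CondLaw

/-- Countability allows an almost sure identity, proved set by set, to hold off one common null set.
-/
lemma exists_countable_piSystem (E : Type*) [mE : MeasurableSpace E] [StandardBorelSpace E] :
    ∃ C : Set (Set E), C.Countable ∧ IsPiSystem C ∧ mE = MeasurableSpace.generateFrom C := by
  obtain ⟨f, hf⟩ := exists_measurableEmbedding_real E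
  refine ⟨Set.preimage f '' ⋃ a : ℚ, {Set.Iic (a : ℝ)}, ?_, ?_, ?_⟩
  · exact (Set.countable_iUnion fun a => Set.countable_singleton _).image _
  · exact Real.isPiSystem_Iic_rat.comap f
  · rw [← MeasurableSpace.comap_generateFrom, ← Real.borel_eq_generateFrom_Iic_rat,
      ← BorelSpace.measurable_eq (α := ℝ), hf.comap_eq]

end MDSBerryEsseen

/-! ### Passing conditional expectations to the regular conditional laws. -/

namespace MDSBerryEsseen

/-- Writing `a - b = w` with sums of nonnegative terms lets the identity be integrated in `[0, ∞]`,
although the variables need not be integrable. The next lemma goes back to real numbers. -/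
lemma add_ofReal_neg_eq {a b : ENNReal} (ha : a < ⊤) (hb : b < ⊤) {w : ℝ}
    (hw : w = a.toReal - b.toReal) : a + ENNReal.ofReal (-w) = b + ENNReal.ofReal w := by
  rw [← ENNReal.toReal_eq_toReal_iff' (by finiteness) (by finiteness),
    ENNReal.toReal_add ha.ne (by finiteness), ENNReal.toReal_add hb.ne (by finiteness),
    ENNReal.toReal_ofReal', ENNReal.toReal_ofReal']
  rcases le_total w 0 with h | h
  · rw [max_eq_left (by linarith), max_eq_right h]; linarith
  · rw [max_eq_right (by linarith), max_eq_left h]; linarith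

lemma toReal_sub_toReal_eq {a b k : ENNReal} (ha : a < ⊤) (hb : b < ⊤) (hk : k < ⊤) {w : ℝ}
    (h : a + ENNReal.ofReal (-w) * k = b + ENNReal.ofReal w * k) :
    a.toReal - b.toReal = w * k.toReal := by
  have h1 := congrArg ENNReal.toReal h
  have f1 : ENNReal.ofReal (-w) * k ≠ ⊤ := ENNReal.mul_ne_top (by finiteness) hk.ne
  have f2 : ENNReal.ofReal w * k ≠ ⊤ := ENNReal.mul_ne_top (by finiteness) hk.ne
  rw [ENNReal.toReal_add ha.ne f1, ENNReal.toReal_add hb.ne f2, ENNReal.toReal_mul,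
    ENNReal.toReal_mul, ENNReal.toReal_ofReal', ENNReal.toReal_ofReal'] at h1
  rcases le_total w 0 with h | h
  · rw [max_eq_left (by linarith), max_eq_right h] at h1; linarith
  · rw [max_eq_right (by linarith), max_eq_left h] at h1; linarith

/-- If the conditional expectation of `f(Y)` given a finer σ-field is measurable with respect to the
coarser one, then under almost every regular conditional law the conditional expectation of `f`
given any `S` observable at the finer level is deterministic. -/
lemma condExp_condLaw_ae_eq_const {Ω E G : Type*} {m m' mΩ : MeasurableSpace Ω}
    {mE : MeasurableSpace E} [StandardBorelSpace E] [Nonempty E] {mG : MeasurableSpace G}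
    [StandardBorelSpace G] {μ : Measure[mΩ] Ω} [IsProbabilityMeasure μ] {Y : Ω → E}
    (hm : m ≤ m') (hm' : m' ≤ mΩ) (hY : Measurable[mΩ] Y) {f : E → ℝ} (hf : Measurable f)
    {S : E → G} (hS : Measurable S) (hSY : Measurable[m'] fun ω => S (Y ω))
    (hfin : ∀ᵐ ω ∂μ, ∫⁻ y, ‖f y‖ₑ ∂(condLaw m μ Y ω) < ⊤) {W : Ω → ℝ} (hWm : Measurable[m] W)
    (hW : W =ᵐ[μ] condExpect m' μ fun ω => f (Y ω)) :
    ∀ᵐ ω ∂μ, (condLaw m μ Y ω)[f | MeasurableSpace.comap S mG]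
      =ᵐ[condLaw m μ Y ω] fun _ => W ω := by
  set pos : E → ENNReal := fun y => ENNReal.ofReal (f y) with hpos
  set neg : E → ENNReal := fun y => ENNReal.ofReal (-f y) with hneg
  have mpos : Measurable pos := hf.ennreal_ofReal
  have mneg : Measurable neg := hf.neg.ennreal_ofReal
  have lepos : pos ≤ fun y => ‖f y‖ₑ := fun y => Real.ofReal_le_enorm _
  have leneg : neg ≤ fun y => ‖f y‖ₑ := fun y => by
    simpa using Real.ofReal_le_enorm (-f y)
  have fpos := condLExp_lt_top_of_le hm hm' hY hf.enorm lepos hfin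
  have fneg := condLExp_lt_top_of_le hm hm' hY hf.enorm leneg hfin
  have hpq : ∀ᵐ ω ∂μ, condLExp m' μ (fun ω => pos (Y ω)) ω + ENNReal.ofReal (-W ω) =
      condLExp m' μ (fun ω => neg (Y ω)) ω + ENNReal.ofReal (W ω) := by
    filter_upwards [fpos, fneg, hW] with ω h1 h2 h3
    exact add_ofReal_neg_eq h1 h2 h3
  -- Disintegration over `m` on the left, conditioning on `m'` on the right: `{S(Y) ∈ A} ∩ B`
  -- belongs to `m'`, so `φ(Y)` may be replaced there by its conditional expectation.
  have side : ∀ (φ : E → ENNReal), Measurable φ → ∀ (g : Ω → ENNReal), Measurable[m] g →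
      ∀ A : Set G, MeasurableSet A → ∀ B : Set Ω, MeasurableSet[m] B →
      ∫⁻ ω in B, ((∫⁻ y, (S ⁻¹' A).indicator φ y ∂(condLaw m μ Y ω)) +
        g ω * ∫⁻ y, (S ⁻¹' A).indicator 1 y ∂(condLaw m μ Y ω)) ∂μ =
      ∫⁻ ω in (fun ω => S (Y ω)) ⁻¹' A ∩ B, (condLExp m' μ (fun ω => φ (Y ω)) ω + g ω) ∂μ := by
    intro φ hφ g hg A hA B hB
    have hD : MeasurableSet[m'] ((fun ω => S (Y ω)) ⁻¹' A) := hSY hA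
    have hDB := hD.inter (hm _ hB)
    have m1 : Measurable ((S ⁻¹' A).indicator φ) := hφ.indicator (hS hA)
    have m2 : Measurable ((S ⁻¹' A).indicator (1 : E → ENNReal)) :=
      measurable_one.indicator (hS hA)
    have e1 := setLIntegral_lintegral_condLaw (μ := μ) (hm.trans hm') hY m1 (g := fun _ => 1)
      measurable_const hB
    have e2 := setLIntegral_lintegral_condLaw (μ := μ) (hm.trans hm') hY m2 hg hB
    simp only [one_mul] at e1
    rw [lintegral_add_left ((measurable_lintegral_condLaw m1).mono (hm.trans hm') le_rfl), e1, e2,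
      lintegral_add_left (measurable_condLExp' _ _ _), setLIntegral_condLExp hm' μ _ hDB,
      ← setLIntegral_indicator (hm' _ hD), ← setLIntegral_indicator (hm' _ hD)]
    congr 1
    refine lintegral_congr fun ω => ?_
    by_cases hω : S (Y ω) ∈ A <;> simp [Set.indicator, hω]
  have key : ∀ A : Set G, MeasurableSet A → ∀ᵐ ω ∂μ,
      (∫⁻ y, (S ⁻¹' A).indicator pos y ∂(condLaw m μ Y ω)) +
        ENNReal.ofReal (-W ω) * ∫⁻ y, (S ⁻¹' A).indicator 1 y ∂(condLaw m μ Y ω) =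
      (∫⁻ y, (S ⁻¹' A).indicator neg y ∂(condLaw m μ Y ω)) +
        ENNReal.ofReal (W ω) * ∫⁻ y, (S ⁻¹' A).indicator 1 y ∂(condLaw m μ Y ω) := by
    intro A hA
    have m1 := measurable_lintegral_condLaw (m := m) (μ := μ) (Y := Y) (mpos.indicator (hS hA))
    have m2 := measurable_lintegral_condLaw (m := m) (μ := μ) (Y := Y) (mneg.indicator (hS hA))
    have m3 := measurable_lintegral_condLaw (m := m) (μ := μ) (Y := Y)
      ((measurable_one : Measurable (1 : E → ENNReal)).indicator (hS hA))
    have mW1 : Measurable[m] fun ω => ENNReal.ofReal (-W ω) := hWm.neg.ennreal_ofReal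
    have mW2 : Measurable[m] fun ω => ENNReal.ofReal (W ω) := hWm.ennreal_ofReal
    refine ae_eq_of_setLIntegral_eq (hm.trans hm') (m1.add (mW1.mul m3)) (m2.add (mW2.mul m3))
      fun B hB => ?_
    rw [side pos mpos _ mW1 A hA B hB, side neg mneg _ mW2 A hA B hB]
    refine lintegral_congr_ae (ae_restrict_of_ae ?_)
    filter_upwards [hpq] with ω h using h
  obtain ⟨C, hCc, hCpi, hCgen⟩ := exists_countable_piSystem G
  have hCm : ∀ A ∈ C, MeasurableSet A := fun A hA => by
    rw [hCgen]
    exact MeasurableSpace.measurableSet_generateFrom hA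
  have hall : ∀ᵐ ω ∂μ, ∀ A ∈ C, (∫⁻ y, (S ⁻¹' A).indicator pos y ∂(condLaw m μ Y ω)) +
        ENNReal.ofReal (-W ω) * ∫⁻ y, (S ⁻¹' A).indicator 1 y ∂(condLaw m μ Y ω) =
      (∫⁻ y, (S ⁻¹' A).indicator neg y ∂(condLaw m μ Y ω)) +
        ENNReal.ofReal (W ω) * ∫⁻ y, (S ⁻¹' A).indicator 1 y ∂(condLaw m μ Y ω) :=
    (ae_ball_iff hCc).2 fun A hA => key A (hCm A hA)
  filter_upwards [hfin, hall, key Set.univ MeasurableSet.univ] with ω hω hC huniv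
  set κ := condLaw m μ Y ω with hκ
  have hint : Integrable f κ := ⟨hf.aestronglyMeasurable, hω⟩
  have p1 : ∫⁻ y, pos y ∂κ < ⊤ := (lintegral_mono lepos).trans_lt hω
  have p2 : ∫⁻ y, neg y ∂κ < ⊤ := (lintegral_mono leneg).trans_lt hω
  -- For fixed `ω` the identity says that two finite measures on `G` agree on the countable π-system
  -- and on the whole space. Hence they agree on every measurable set, which characterises the
  -- conditional expectation given `S`.
  set ν : (E → ENNReal) → ENNReal → Measure G := fun φ c =>
    (κ.withDensity φ).map S + c • κ.map S with hν
  have hνA : ∀ φ c A, MeasurableSet A → ν φ c A =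
      ∫⁻ y, (S ⁻¹' A).indicator φ y ∂κ + c * ∫⁻ y, (S ⁻¹' A).indicator 1 y ∂κ := by
    intro φ c A hA
    rw [lintegral_indicator (hS hA), lintegral_indicator_one (hS hA)]
    simp only [hν, Measure.coe_add, Measure.coe_smul, Pi.add_apply, Pi.smul_apply, smul_eq_mul]
    rw [Measure.map_apply hS hA, Measure.map_apply hS hA, withDensity_apply _ (hS hA)]
  have hνeq : ν pos (ENNReal.ofReal (-W ω)) = ν neg (ENNReal.ofReal (W ω)) := by
    have hfinm : IsFiniteMeasure (ν pos (ENNReal.ofReal (-W ω))) := by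
      refine ⟨?_⟩
      rw [hνA _ _ _ MeasurableSet.univ]
      simp only [Set.preimage_univ, Set.indicator_univ, Pi.one_apply, lintegral_one, measure_univ,
        mul_one]
      exact ENNReal.add_lt_top.2 ⟨p1, ENNReal.ofReal_lt_top⟩
    refine ext_of_generate_finite C hCgen hCpi (fun A hA => ?_) ?_
    · rw [hνA _ _ _ (hCm A hA), hνA _ _ _ (hCm A hA)]
      exact hC A hA
    · rw [hνA _ _ _ MeasurableSet.univ, hνA _ _ _ MeasurableSet.univ]
      exact huniv
  refine (ae_eq_condExp_of_forall_setIntegral_eq hS.comap_le hint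
    (fun _ _ _ => (integrable_const _).integrableOn) ?_
    aestronglyMeasurable_const).symm
  rintro _ ⟨A, hA, rfl⟩ -
  have h1 := congrArg (fun μ : Measure G => μ A) hνeq
  beta_reduce at h1
  rw [hνA _ _ _ hA, hνA _ _ _ hA, lintegral_indicator_one (hS hA), lintegral_indicator (hS hA),
    lintegral_indicator (hS hA)] at h1
  have h2 := toReal_sub_toReal_eq ((setLIntegral_le_lintegral _ _).trans_lt p1)
    ((setLIntegral_le_lintegral _ _).trans_lt p2) (measure_lt_top κ _) h1
  rw [integral_eq_lintegral_pos_part_sub_lintegral_neg_part hint.integrableOn, h2]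
  simp [measureReal_def, mul_comm]

end MDSBerryEsseen

/-! ### The conditional laws of the Gaussian vector and of the martingale differences. -/

namespace MDSBerryEsseen

section Assembly

variable {Ω : Type*} {mΩ : MeasurableSpace Ω} {μ : Measure Ω} [IsProbabilityMeasure μ] {n d : ℕ}

/-- The coordinate process on `(ℝ^d)^n`, extended by zero. -/
def coordSeq (n d i : ℕ) (y : Fin n → Fin d → ℝ) : Fin d → ℝ :=
  if h : i < n then y ⟨i, h⟩ else 0

lemma measurable_coordSeq (i : ℕ) : Measurable (coordSeq n d i) := by
  unfold coordSeq
  split_ifs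
  · fun_prop
  · exact measurable_const

lemma coordSeq_of_lt {i : ℕ} (h : i < n) :
    coordSeq n d i = fun y => y ⟨i, h⟩ := by
  ext y
  simp [coordSeq, h]

lemma partialSum_coordSeq (y : Fin n → Fin d → ℝ) :
    partialSum (coordSeq n d) n y = ∑ i, y i := by
  rw [partialSum, Finset.sum_range]
  exact Finset.sum_congr rfl fun i _ => by simp [coordSeq]

/-- Almost every regular conditional law of the gaussian vector is the corresponding normal
distribution. -/
lemma IsCondGaussian.ae_hasGaussianCharFun {m : MeasurableSpace Ω} (hm : m ≤ mΩ)
    {T : Ω → Fin d → ℝ} {V : Ω → Matrix (Fin d) (Fin d) ℝ} (hT : IsCondGaussian m μ T V) :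
    ∀ᵐ ω ∂μ, HasGaussianCharFun (condLaw m μ T ω) (V ω) := by
  -- The exceptional null set depends on the argument. Countably many rational arguments share one,
  -- and continuity in `t` covers the rest.
  have hq : ∀ q : Fin d → ℚ, ∀ᵐ ω ∂μ,
      ∫ x, Complex.exp (Complex.I * (((fun j => (q j : ℝ)) ⬝ᵥ x : ℝ) : ℂ)) ∂(condLaw m μ T ω) =
        ((Real.exp (-(1 / 2) * ((fun j => (q j : ℝ)) ⬝ᵥ (V ω).mulVec (fun j => (q j : ℝ)))) : ℝ) :
          ℂ) := by
    intro q
    have hmeas : Measurable fun x : Fin d → ℝ =>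
        Complex.exp (Complex.I * (((fun j => (q j : ℝ)) ⬝ᵥ x : ℝ) : ℂ)) := by
      have := measurable_dotProduct (fun j => (q j : ℝ))
      fun_prop
    have h1 := condExp_comp_ae_eq (μ := μ) hm hT.1 hmeas.stronglyMeasurable
      ((integrable_const (1 : ℝ)).mono' (hmeas.comp hT.1).aestronglyMeasurable
        (ae_of_all _ fun ω => by rw [mul_comm, Complex.norm_exp_ofReal_mul_I]))
    filter_upwards [h1, hT.2 fun j => (q j : ℝ)] with ω e1 e2
    rw [← e1, e2]
  filter_upwards [ae_all_iff.2 hq] with ω hω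
  have hdense : DenseRange fun q : Fin d → ℚ => fun j => ((q j : ℚ) : ℝ) :=
    DenseRange.piMap fun _ => Rat.denseRange_cast
  have c1 : Continuous fun t : Fin d → ℝ =>
      ∫ x, Complex.exp (Complex.I * ((t ⬝ᵥ x : ℝ) : ℂ)) ∂(condLaw m μ T ω) := by
    refine continuous_of_dominated (bound := fun _ => 1) (fun t => ?_) (fun t => ?_)
      (integrable_const _) (ae_of_all _ fun x => ?_)
    · have := measurable_dotProduct t
      exact Measurable.aestronglyMeasurable (by fun_prop)
    · exact ae_of_all _ fun x => by rw [mul_comm, Complex.norm_exp_ofReal_mul_I]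
    · simp only [dotProduct]
      fun_prop
  have c2 : Continuous fun t : Fin d → ℝ =>
      ((Real.exp (-(1 / 2) * (t ⬝ᵥ (V ω).mulVec t)) : ℝ) : ℂ) := by
    simp only [dotProduct, Matrix.mulVec]
    fun_prop
  have := hdense.equalizer c1 c2 (funext hω)
  exact fun t => congrFun this t

/-- A conditional distribution function agrees at rational points with that of the regular
conditional law. -/
lemma IsCondCDF.ae_eq_condLaw {m : MeasurableSpace Ω} (hm : m ≤ mΩ) {E : Type*}
    {mE : MeasurableSpace E} [StandardBorelSpace E] [Nonempty E] {Y : Ω → E} (hY : Measurable[mΩ] Y)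
    {Z : E → ℝ} (hZ : Measurable Z) {G : Ω → ℝ → ℝ} (hG : IsCondCDF m μ (fun ω => Z (Y ω)) G) :
    ∀ᵐ ω ∂μ, ∀ q : ℚ, G ω q = (condLaw m μ Y ω).real {y | Z y ≤ q} := by
  refine ae_all_iff.2 fun q => ?_
  have hs : MeasurableSet {y | Z y ≤ (q : ℝ)} := measurableSet_le hZ measurable_const
  have hf : Measurable ({y | Z y ≤ (q : ℝ)}.indicator fun _ => (1 : ℝ)) :=
    measurable_const.indicator hs
  have h1 := condExp_comp_ae_eq (μ := μ) hm hY hf.stronglyMeasurable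
    ((integrable_const (1 : ℝ)).mono' (hf.comp hY).aestronglyMeasurable (ae_of_all _ fun ω => by
      by_cases h : Z (Y ω) ≤ q <;> simp [Set.indicator, h]))
  filter_upwards [h1, hG.ae_eq q] with ω e1 e2
  rw [e2]
  refine Eq.trans ?_ (e1.trans ?_)
  · rfl
  · rw [integral_indicator hs]
    simp

/-- A bound on the difference of two right-continuous functions at all rational points holds for
the supremum. -/
lemma kolmogorovDist_le {G H : Ω → ℝ → ℝ} {ω : Ω}
    (hG : ∀ r, ContinuousWithinAt (G ω) (Set.Ici r) r)
    (hH : ∀ r, ContinuousWithinAt (H ω) (Set.Ici r) r) {b : ℝ}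
    (h : ∀ q : ℚ, |G ω q - H ω q| ≤ b) : kolmogorovDist G H ω ≤ b := by
  refine ciSup_le fun r => ?_
  by_contra! hlt
  have hc : ContinuousWithinAt (fun s => |G ω s - H ω s|) (Set.Ici r) r := ((hG r).sub (hH r)).abs
  have hev : ∀ᶠ s in 𝓝[>] r, b < |G ω s - H ω s| :=
    (hc.tendsto.mono_left (nhdsWithin_mono _ Set.Ioi_subset_Ici_self)).eventually_const_lt hlt
  obtain ⟨u, hu, hsub⟩ := mem_nhdsGT_iff_exists_Ioo_subset.1 hev
  obtain ⟨q, hq1, hq2⟩ := exists_rat_btwn (Set.mem_Ioi.1 hu)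
  exact absurd (h q) (not_le.2 (hsub ⟨hq1, hq2⟩))

/-- Almost every regular conditional law of a martingale difference sequence has deterministic
conditional covariances, namely the given `F 0`-measurable versions. -/
lemma IsMDS.ae_hasCondMoments {F : Filtration (Fin (n + 1)) mΩ} {X : Fin n → Ω → Fin d → ℝ}
    (hX : IsMDS μ F X) {W : Fin n → Ω → Matrix (Fin d) (Fin d) ℝ}
    (hWm : ∀ i j k, Measurable[F 0] fun ω => W i ω j k)
    (hW : ∀ i, W i =ᵐ[μ] condSecondMoment (F i.castSucc) μ (X i)) :
    ∀ᵐ ω ∂μ, HasCondMoments (condLaw (F 0) μ (fun ω i => X i ω) ω) (coordSeq n d) n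
      (fun i => if h : i < n then W ⟨i, h⟩ ω else 0) := by
  set Y : Ω → Fin n → Fin d → ℝ := fun ω i => X i ω with hY
  have hYm : Measurable Y := measurable_pi_iff.2 fun i => (hX.adapted i).mono (F.le _) le_rfl
  have h3 : ∀ i, ∀ᵐ ω ∂μ, ∫⁻ y, ‖y i‖ₑ ^ 3 ∂(condLaw (F 0) μ Y ω) < ⊤ := by
    intro i
    have := condLExp_comp_ae_eq (μ := μ) (F.le 0) hYm
      (f := fun y : Fin n → Fin d → ℝ => ‖y i‖ₑ ^ 3) (by fun_prop)
    filter_upwards [this, hX.third_moment i] with ω e1 e2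
    rw [← e1]
    exact e2
  have hint : ∀ i, ∀ᵐ ω ∂μ, Integrable (fun y => ‖y i‖ ^ 3) (condLaw (F 0) μ Y ω) := by
    intro i
    filter_upwards [h3 i] with ω hω
    refine ⟨Measurable.aestronglyMeasurable (by fun_prop), ?_⟩
    simpa [HasFiniteIntegral, enorm_pow] using hω
  have hS : ∀ i : Fin n, Measurable[F i.castSucc]
      fun ω => partialSum (coordSeq n d) i (Y ω) := by
    intro i
    unfold partialSum
    refine Finset.measurable_sum _ fun k hk => ?_
    have hk' : k < n := (Finset.mem_range.1 hk).trans i.2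
    rw [coordSeq_of_lt hk']
    -- `X k` is measurable at level `k + 1`, and the partial sum before step `i` involves only `k <
    -- i`.
    refine (hX.adapted ⟨k, hk'⟩).mono (F.mono ?_) le_rfl
    have := Finset.mem_range.1 hk
    simp only [Fin.le_def, Fin.val_succ, Fin.val_castSucc]
    omega
  have hSm : ∀ i, Measurable (partialSum (coordSeq n d) i) :=
    measurable_partialSum measurable_coordSeq
  have hmean : ∀ (i : Fin n) (j : Fin d), ∀ᵐ ω ∂μ, (condLaw (F 0) μ Y ω)[fun y => y i j |
      MeasurableSpace.comap (partialSum (coordSeq n d) i) inferInstance]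
        =ᵐ[condLaw (F 0) μ Y ω] fun _ => 0 := by
    intro i j
    refine condExp_condLaw_ae_eq_const (W := fun _ => 0) (F.mono (Fin.zero_le _)) (F.le _) hYm
      (f := fun y : Fin n → Fin d → ℝ => y i j) (by fun_prop) (hSm i) (hS i) ?_ measurable_const ?_
    · filter_upwards [hint i] with ω hω
      exact (integrable_coord (X := fun y : Fin n → Fin d → ℝ => y i) (by fun_prop) hω j).2
    · filter_upwards [hX.condExpect_eq_zero i j] with ω hω using hω.symm
  have hcov : ∀ (i : Fin n) (j k : Fin d), ∀ᵐ ω ∂μ, (condLaw (F 0) μ Y ω)[fun y => y i j * y i k |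
      MeasurableSpace.comap (partialSum (coordSeq n d) i) inferInstance]
        =ᵐ[condLaw (F 0) μ Y ω] fun _ => W i ω j k := by
    intro i j k
    refine condExp_condLaw_ae_eq_const (W := fun ω => W i ω j k) (F.mono (Fin.zero_le _)) (F.le _)
      hYm (f := fun y : Fin n → Fin d → ℝ => y i j * y i k) (by fun_prop) (hSm i) (hS i) ?_
      (hWm i j k) ?_
    · filter_upwards [hint i] with ω hω
      exact (integrable_coord_mul (X := fun y : Fin n → Fin d → ℝ => y i)
        (Y := fun y : Fin n → Fin d → ℝ => y i) (by fun_prop) (by fun_prop) hω hω j k).2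
    · filter_upwards [hW i] with ω hω
      rw [hω]
      rfl
  filter_upwards [ae_all_iff.2 hint, ae_all_iff.2 fun i => ae_all_iff.2 (hmean i),
    ae_all_iff.2 fun i => ae_all_iff.2 fun j => ae_all_iff.2 (hcov i j)] with ω w1 w2 w3
  refine ⟨measurable_coordSeq, fun i hi => ?_, fun i hi j => ?_, fun i hi j k => ?_⟩
  · simp only [coordSeq_of_lt hi]
    exact w1 ⟨i, hi⟩
  · simp only [coordSeq_of_lt hi]
    exact w2 ⟨i, hi⟩ j
  · simp only [coordSeq_of_lt hi, hi, dif_pos]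
    exact w3 ⟨i, hi⟩ j k

end Assembly

end MDSBerryEsseen

/-! ### Identification of `V` and `Γ` under the conditional laws, and conclusion. -/

namespace MDSBerryEsseen

lemma measurable_condExpect {Ω : Type*} (m : MeasurableSpace Ω) {mΩ : MeasurableSpace Ω}
    (μ : Measure Ω) (f : Ω → ℝ) : Measurable[m] (condExpect m μ f) :=
  (measurable_condLExp m μ _).ennreal_toReal.sub (measurable_condLExp m μ _).ennreal_toReal

/-- Almost surely, the conditional covariance matrix and the conditional moment sum are those of
the regular conditional law. -/
lemma ae_moments_condLaw {Ω : Type*} {m mΩ : MeasurableSpace Ω} {μ : Measure Ω}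
    [IsProbabilityMeasure μ] {n d : ℕ} (hm : m ≤ mΩ)
    {X : Fin n → Ω → Fin d → ℝ} (hX : ∀ i, Measurable[mΩ] (X i))
    {A : Ω → ℕ → Matrix (Fin d) (Fin d) ℝ}
    (h : ∀ᵐ ω ∂μ, HasCondMoments (condLaw m μ (fun ω i => X i ω) ω) (coordSeq n d) n (A ω)) :
    ∀ᵐ ω ∂μ, condSecondMoment m μ (total X) ω = ∑ i ∈ Finset.range n, A ω i ∧
      bigGamma m μ X ω = ∑ i ∈ Finset.range n,
        (∫ y, ‖coordSeq n d i y‖ ^ 3 ∂(condLaw m μ (fun ω i => X i ω) ω) +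
          ((⨆ j, A ω i j j) * lnp d) ^ (3 / 2 : ℝ)) := by
  set Y : Ω → Fin n → Fin d → ℝ := fun ω i => X i ω with hY
  have hYm : Measurable[mΩ] Y := measurable_pi_iff.2 hX
  have hP := measurable_partialSum (measurable_coordSeq (n := n) (d := d)) n
  have htot : ∀ ω, total X ω = partialSum (coordSeq n d) n (Y ω) := fun ω => by
    rw [partialSum_coordSeq, total]
  have hV : ∀ j k, ∀ᵐ ω ∂μ, condSecondMoment m μ (total X) ω j k =
      ∫ y, partialSum (coordSeq n d) n y j * partialSum (coordSeq n d) n y k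
        ∂(condLaw m μ Y ω) := by
    intro j k
    have hf : Measurable fun y : Fin n → Fin d → ℝ =>
        partialSum (coordSeq n d) n y j * partialSum (coordSeq n d) n y k := by fun_prop
    filter_upwards [condExpect_comp_ae_eq (μ := μ) hm hYm hf (by
      filter_upwards [h] with ω hω
      have h3 := integrable_cube_partialSum hω.measurable hω.integrable
      exact integrable_coord_mul hP hP h3 h3 j k)] with ω hω
    rw [← hω]
    simp only [condSecondMoment, Matrix.of_apply, htot]
  have hC : ∀ (i : Fin n) j, ∀ᵐ ω ∂μ, condSecondMoment m μ (X i) ω j j =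
      ∫ y, y i j * y i j ∂(condLaw m μ Y ω) := by
    intro i j
    have hf : Measurable fun y : Fin n → Fin d → ℝ => y i j * y i j := by fun_prop
    filter_upwards [condExpect_comp_ae_eq (μ := μ) hm hYm hf (by
      filter_upwards [h] with ω hω
      have h3 := hω.integrable i i.2
      have := integrable_coord_mul (hω.measurable i) (hω.measurable i) h3 h3 j j
      simpa only [coordSeq_of_lt i.2] using this)] with ω hω
    rw [← hω]
    rfl
  have hN : ∀ i : Fin n, ∀ᵐ ω ∂μ, condExpect m μ (fun x => ‖X i x‖ ^ 3) ω =
      ∫ y, ‖y i‖ ^ 3 ∂(condLaw m μ Y ω) := by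
    intro i
    have hf : Measurable fun y : Fin n → Fin d → ℝ => ‖y i‖ ^ 3 := by fun_prop
    filter_upwards [condExpect_comp_ae_eq (μ := μ) hm hYm hf (by
      filter_upwards [h] with ω hω
      have := hω.integrable i i.2
      simpa only [coordSeq_of_lt i.2] using this)] with ω hω
    rw [← hω]
  filter_upwards [h, ae_all_iff.2 fun j => ae_all_iff.2 (hV j),
    ae_all_iff.2 fun i => ae_all_iff.2 (hC i), ae_all_iff.2 hN] with ω w h1 h2 h3
  refine ⟨?_, ?_⟩
  · ext j k
    rw [h1 j k, w.integral_partialSum_mul]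
  · rw [bigGamma, Finset.sum_range]
    refine Finset.sum_congr rfl fun i _ => ?_
    have hA : ∀ j, condSecondMoment m μ (X i) ω j j = A ω i j j := fun j => by
      rw [h2 i j, ← w.cov_eq i.2]
      simp only [coordSeq_of_lt i.2]
    simp only [hA, h3 i, coordSeq_of_lt i.2]

/-- The argument gives a bound without `τ`; this inequality allows the factor `τ³` to be inserted.
-/
lemma one_le_tau {d : ℕ} [Nonempty (Fin d)] {V : Matrix (Fin d) (Fin d) ℝ} (h : 0 < vLow V) :
    1 ≤ tau V := by
  rw [tau, one_le_div h]
  refine Real.sqrt_le_sqrt ?_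
  have j : Fin d := Classical.arbitrary _
  exact (ciInf_le (f := fun j => V j j) (Set.finite_range _).bddBelow j).trans
    (le_ciSup (f := fun j => V j j) (Set.finite_range _).bddAbove j)

lemma vLow_sq_le {d : ℕ} {V : Matrix (Fin d) (Fin d) ℝ} (h : 0 < vLow V) (k : Fin d) :
    vLow V ^ 2 ≤ V k k := by
  rw [vLow, Real.sq_sqrt (Real.sqrt_pos.1 h).le]
  exact ciInf_le (f := fun j => V j j) (Set.finite_range _).bddBelow k

end MDSBerryEsseen

open MDSBerryEsseen in
theorem corollary1 :
    ∃ C : ℝ, 0 < C ∧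
      ∀ {Ω : Type*} {mΩ : MeasurableSpace Ω} (μ : Measure Ω) [IsProbabilityMeasure μ]
        (n d : ℕ) (_hd : 1 < d)
        (F : Filtration (Fin (n + 1)) mΩ) (X : Fin n → Ω → Fin d → ℝ)
        (_hX : MDSBerryEsseen.IsMDS μ F X)
        -- `V` is a version of `E[S Sᵀ ∣ F_0]`
        (V : Ω → Matrix (Fin d) (Fin d) ℝ)
        (_hVm : ∀ j k, Measurable[F 0] fun ω => V ω j k)
        (_hV : V =ᵐ[μ] MDSBerryEsseen.condSecondMoment (F 0) μ (MDSBerryEsseen.total X))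
        (T : Ω → Fin d → ℝ) (_hT : MDSBerryEsseen.IsCondGaussian (F 0) μ T V)
        -- regular conditional distribution functions of `M(S)` and `M(T)` given `F_0`
        (GS GT : Ω → ℝ → ℝ)
        (_hGS : MDSBerryEsseen.IsCondCDF (F 0) μ
          (fun ω => MDSBerryEsseen.maxCoord (MDSBerryEsseen.total X ω)) GS)
        (_hGT : MDSBerryEsseen.IsCondCDF (F 0) μ
          (fun ω => MDSBerryEsseen.maxCoord (T ω)) GT)
        (_hv : ∀ᵐ ω ∂μ, 0 < MDSBerryEsseen.vLow (V ω))
        -- for `1 < i ≤ n`, `E[X_i X_iᵀ ∣ F_{i-1}]` has an `F_0`-measurable version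
        (_hcov : ∀ i : Fin n, 0 < (i : ℕ) → ∃ W : Ω → Matrix (Fin d) (Fin d) ℝ,
          (∀ j k, Measurable[F 0] fun ω => W ω j k) ∧
          W =ᵐ[μ] MDSBerryEsseen.condSecondMoment (F i.castSucc) μ (X i)),
        ∀ᵐ ω ∂μ, MDSBerryEsseen.kolmogorovDist GS GT ω ≤
          C * Real.log ((d : ℝ) * n) ^ (7 / 8 : ℝ) *
            (MDSBerryEsseen.tau (V ω) ^ 3 *
              (MDSBerryEsseen.bigGamma (F 0) μ X ω / MDSBerryEsseen.vLow (V ω) ^ 3))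
                ^ (1 / 4 : ℝ) := by 
  -- The bound is applied on the path space `Fin n → Fin d → ℝ`, which lies in universe `0` whatever
  -- the universe of `Ω`.
  obtain ⟨C, hC, hbound⟩ := exists_kolmogorov_bound.{0}
  refine ⟨C, hC, ?_⟩
  intro Ω mΩ μ _ n d hd F X hX V hVm hV T hT GS GT hGS hGT hv hcov
  have : Nonempty (Fin d) := ⟨⟨0, by omega⟩⟩
  have hW : ∀ i : Fin n, ∃ W : Ω → Matrix (Fin d) (Fin d) ℝ,
      (∀ j k, Measurable[F 0] fun ω => W ω j k) ∧
        W =ᵐ[μ] condSecondMoment (F i.castSucc) μ (X i) := by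
    intro i
    -- The first increment is conditioned on `F 0` itself, so its conditional second moment is
    -- already `F 0`-measurable.
    rcases Nat.eq_zero_or_pos (i : ℕ) with hi | hi
    · have h0 : i.castSucc = 0 := Fin.ext hi
      rw [h0]
      exact ⟨_, fun j k => measurable_condExpect (F 0) μ _, EventuallyEq.rfl⟩
    · exact hcov i hi
  choose W hWm hWeq using hW
  have hXm : ∀ i, Measurable (X i) := fun i => (hX.adapted i).mono (F.le _) le_rfl
  have hYm : Measurable fun ω (i : Fin n) => X i ω := measurable_pi_iff.2 hXm
  have hmom := hX.ae_hasCondMoments hWm hWeq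
  have hP := measurable_partialSum (measurable_coordSeq (n := n) (d := d)) n
  have hGS' : IsCondCDF (F 0) μ
      (fun ω => maxCoord (partialSum (coordSeq n d) n fun i => X i ω)) GS := by
    simp only [partialSum_coordSeq]
    exact hGS
  filter_upwards [hmom, ae_moments_condLaw (F.le 0) hXm hmom, hV,
    hT.ae_hasGaussianCharFun (F.le 0), hGS'.ae_eq_condLaw (F.le 0) hYm
      (measurable_maxCoord.comp hP), hGT.ae_eq_condLaw (F.le 0) hT.1 measurable_maxCoord, hv]
    with ω hω hω2 hVω hTω hGSω hGTω hvω
  obtain ⟨hVsum, hΓ⟩ := hω2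
  rw [← hVω] at hVsum
  rw [hVsum] at hTω
  have hvk := vLow_sq_le hvω
  -- An empty sum would have zero covariance, against `vLow (V ω) > 0`. Positivity of `n` is what
  -- gives `log d ≤ log (d n)`.
  have hn : 0 < n := by
    rcases Nat.eq_zero_or_pos n with rfl | hn
    · have := hvk (Classical.arbitrary _)
      have h2 : 0 < vLow (V ω) ^ 2 := by positivity
      rw [hVsum] at this h2
      simp only [Finset.range_zero, Finset.sum_empty, Matrix.zero_apply] at this h2
      exact absurd h2 (not_lt.2 this)
    · exact hn
  refine kolmogorovDist_le (hGS.right_continuous ω) (hGT.right_continuous ω) fun q => ?_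
  rw [hGSω q, hGTω q]
  refine (hbound hd hω _ hTω hvω (fun k => by rw [← hVsum]; exact hvk k) q).trans ?_
  rw [← hΓ]
  have hΓ0 : 0 ≤ bigGamma (F 0) μ X ω := by
    rw [hΓ]
    refine Finset.sum_nonneg fun i hi => ?_
    have h1 : 0 ≤ ∫ y, ‖coordSeq n d i y‖ ^ 3 ∂(condLaw (F 0) μ (fun ω i => X i ω) ω) :=
      integral_nonneg fun y => by positivity
    have h2 := Real.iSup_nonneg fun j =>
      PosSemidef.diag_nonneg' (hω.posSemidef (Finset.mem_range.1 hi)) j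
    have h3 : 0 ≤ lnp d := zero_le_one.trans (le_max_left _ _)
    exact add_nonneg h1 (Real.rpow_nonneg (mul_nonneg h2 h3) _)
  have hτ := one_le_tau hvω
  have hq0 : 0 ≤ bigGamma (F 0) μ X ω / vLow (V ω) ^ 3 := by positivity
  have hd1 : (1 : ℝ) ≤ d := by exact_mod_cast hd.le
  have hn1 : (1 : ℝ) ≤ n := by exact_mod_cast hn
  have hlog : Real.log d ≤ Real.log (d * n) :=
    Real.log_le_log (by linarith) (le_mul_of_one_le_right (by linarith) hn1)
  have hlog0 : 0 ≤ Real.log d := Real.log_nonneg hd1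
  have hτq : bigGamma (F 0) μ X ω / vLow (V ω) ^ 3 ≤
      tau (V ω) ^ 3 * (bigGamma (F 0) μ X ω / vLow (V ω) ^ 3) :=
    le_mul_of_one_le_left hq0 (one_le_pow₀ hτ)
  have hc0 : 0 ≤ C * Real.log (d * n) ^ (7 / 8 : ℝ) :=
    mul_nonneg hC.le (Real.rpow_nonneg (hlog0.trans hlog) _)
  gcongr
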